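/- Let $r,n\ge 1$ be integers and let $\alpha\in\mathbb F_{2^r}^\times$. Let $C_{2,\alpha}$ be the projective plane curve over $\mathbb F_{2^r}$ with affine equation $$y^2+y=\alpha\left(x^{2^{r+1}+1}+x^{2^r+2}\right),$$ and let $\#C_{2,\alpha}(\mathbb F_{2^{rn}})$ be the number of its $\mathbb F_{2^{rn}}$-rational points, the (unique) point at infinity included. Write $(a,b)$ for the greatest common divisor of $a$ and $b$. If $r$ is odd, then $$\#C_{2,\alpha}(\mathbb F_{2^{rn}})=\begin{cases} (2^{rn}+1)+2^{r(n+1)/2} & \text{if } n\equiv 1,7 \pmod 8,\\ (2^{rn}+1)-2^{r(n+1)/2} & \text{if } n\equiv 3,5 \pmod 8,\\ (2^{rn}+1)+2^{r(n+2)/2} & \text{if } n\equiv 2,6 \pmod 8,\\ 2^{rn}+1 & \text{if } n\equiv 4 \pmod 8,\\ (2^{rn}+1)-2^{r(n+2)/2+1} & \text{if } n\equiv 0 \pmod 8. \end{cases}$$ If $r$ is even and $\alpha\in\{x^3 : x\in\mathbb F_{2^r}\}$, then $$\#C_{2,\alpha}(\mathbb F_{2^{rn}})=\begin{cases} (2^{rn}+1)+2^{r(n+1)/2}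 & \text{if } n\equiv 1,3 \pmod 4,\\ (2^{rn}+1)+2^{r(n+2)/2} & \text{if } n\equiv 2 \pmod 4,\\ (2^{rn}+1)-2^{r(n+2)/2+1} & \text{if } n\equiv 0 \pmod 4. \end{cases}$$ If $r$ is even and $\alpha\notin\{x^3 : x\in\mathbb F_{2^r}\}$, then $$\#C_{2,\alpha}(\mathbb F_{2^{rn}})=\begin{cases} (2^{rn}+1)+2^{r(n+1)/2} & \text{if } (n,6)=1,\\ (2^{rn}+1)+2^{r(n+2)/2} & \text{if } (n,6)=2,\\ (2^{rn}+1)-2^{r(n+1)/2+1} & \text{if } (n,6)=3,\\ (2^{rn}+1)-2^{r(n+2)/2+1} & \text{if } (n,6)=6. \end{cases}$$ -/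

import Mathlib

noncomputable section

open MvPolynomial

/-- The homogeneous form of degree `2 ^ (r + 1) + 1` in the variables `X 0 = x`, `X 1 = y`,
`X 2 = z` that defines the projective plane curve with affine equation (`z = 1`)
`y ^ 2 + y = α * (x ^ (2 ^ (r + 1) + 1) + x ^ (2 ^ r + 2))`. -/
def curveForm {F : Type*} [Field F] (r : ℕ) (α : F) : MvPolynomial (Fin 3) F :=
  X 1 ^ 2 * X 2 ^ (2 ^ (r + 1) - 1) + X 1 * X 2 ^ (2 ^ (r + 1))
    - C α * (X 0 ^ (2 ^ (r + 1) + 1) + X 0 ^ (2 ^ r + 2) * X 2 ^ (2 ^ r - 1))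

/-- The `K`-rational points of the projective plane curve, for an extension `K` of the field `F`
over which the curve is defined: the points of `ℙ²(K)` at which the form vanishes. -/
def curvePoints {F : Type*} [Field F] (r : ℕ) (α : F) (K : Type*) [Field K] [Algebra F K] :
    Set (Projectivization K (Fin 3 → K)) :=
  {P | aeval P.rep (curveForm r α) = 0}

/-- The vanishing of the form does not depend on the homogeneous coordinates chosen. -/
theorem mk_mem_curvePoints {F : Type*} [Field F] (r : ℕ) (α : F) (K : Type*) [Field K]
    [Algebra F K] (v : Fin 3 → K) (hv : v ≠ 0) :
    Projectivization.mk K v hv ∈ curvePoints r α K ↔ aeval v (curveForm r α) = 0 := by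
  obtain ⟨a, ha⟩ := Projectivization.exists_smul_eq_mk_rep K v hv
  have hs : aeval (a • v) (curveForm r α)
      = (a : K) ^ (2 ^ (r + 1) + 1) * aeval v (curveForm r α) := by
    obtain ⟨k, hk⟩ : ∃ k, 2 ^ r = k + 1 := Nat.exists_eq_succ_of_ne_zero (by positivity)
    have h1 : 2 ^ (r + 1) = 2 * k + 2 := by rw [pow_succ, hk]; ring
    have h2 : 2 * k + 2 - 1 = 2 * k + 1 := by omega
    have h3 : k + 1 - 1 = k := by omega
    simp only [curveForm, h1, hk, h2, h3, map_sub, map_add, map_mul, map_pow, aeval_X,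
      algHom_C, Pi.smul_apply, Units.smul_def, smul_eq_mul]
    ring
  rw [curvePoints, Set.mem_ofPred_eq, ← ha, hs]
  simp

end

/-! Write q = 2^r and let K have q^n elements. By Artin–Schreier each x in K carries 1 + ψ(x) affine
points, where ψ(x) = (-1)^Tr(a(x^(2q+1) + x^(q+2))), and one point lies at infinity, so everything
rests on S = ∑ ψ(x) (`card_curvePoints`). The exponent is a quadratic form with polar form Tr(y^(2q)
L(x)), L = `polarMap`, and L depends only on x^(q^2) + x. The answer is governed by
`traceZeroRoots`: the roots of aT^4 = T whose first k iterates under T ↦ T^q sum to zero, with k = n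
for odd n and k = n/2 for even n.

For n = 2m, the x with x^(q^m) + x in F_q form a subgroup H on which ψ = 1, so S localizes to the
orthogonal complement of H (`sum_eq_sum_orthogonal`). There T = `doubleTrace` x satisfies aT^4 = T
(`orthogonal_iff`) and the trace equals aT^3 (`frobSum_curveFun`), which is 0 for T = 0 and 1
otherwise. Hence S = |H|(2 - #roots), sign included (`sum_curveSign_even`).

For odd n, ψ is trivial on the radical, so S^2 = q^(n+1) · #roots (`sq_sum_curveSign_odd`), and the
sign comes from a congruence. If r is even, multiplication by a primitive cube root of unity
preserves ψ and fixes only 0, so S ≡ 1 mod 3. If r is odd, scaling reduces to a = 1; for a prime p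
dividing n, S is congruent mod p to the sum over the subfield of index p, and 2^((p-1)/2) ≡ (2/p)
turns an induction on n into the sign χ₈(n) (`sum_curveSign_odd_of_odd`). -/

/-! ### Frobenius sums and additive Hilbert 90 -/

section FrobeniusSums

open Finset

/-- The sum of the first `k` iterates of `x ↦ x ^ (2 ^ s)`. -/
def frobSum {K : Type*} [Field K] (s k : ℕ) (x : K) : K := ∑ i ∈ range k, x ^ 2 ^ (s * i)

variable {K : Type*} [Field K]

theorem frobSum_zero (s k : ℕ) : frobSum s k (0 : K) = 0 := by
  simp [frobSum]

theorem frobSum_one_add (k l : ℕ) (x : K) :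
    frobSum 1 (k + l) x = frobSum 1 k x + frobSum 1 l (x ^ 2 ^ k) := by
  simp only [frobSum, sum_range_add, one_mul, ← pow_mul, ← pow_add]

theorem pow_two_pow_mul_of_fixed {s : ℕ} {x : K} (hx : x ^ 2 ^ s = x) (i : ℕ) :
    x ^ 2 ^ (s * i) = x := by
  induction i with
  | zero => simp
  | succ i ih => rw [mul_add, mul_one, pow_add, pow_mul, ih, hx]

theorem frobSum_of_fixed (s k : ℕ) (x : K) (hx : x ^ 2 ^ s = x) : frobSum s k x = k * x := by
  simp [frobSum, pow_two_pow_mul_of_fixed hx]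

theorem frobSum_mul_of_fixed (s k : ℕ) (c x : K) (hc : c ^ 2 ^ s = c) :
    frobSum s k (c * x) = c * frobSum s k x := by
  simp only [frobSum, mul_sum, mul_pow, pow_two_pow_mul_of_fixed hc]

/-- The Frobenius sum of an element of the subfield fixed by `x ↦ x ^ (2 ^ k)`. -/
theorem frobSum_one_mul_of_fixed (k l : ℕ) (x : K) (hx : x ^ 2 ^ k = x) :
    frobSum 1 (k * l) x = l * frobSum 1 k x := by
  induction l with
  | zero => simp [frobSum]
  | succ l ih =>
    rw [mul_add, mul_one, frobSum_one_add, ih, pow_two_pow_mul_of_fixed hx]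
    push_cast; ring

variable [CharP K 2]

theorem frobSum_add (s k : ℕ) (x y : K) :
    frobSum s k (x + y) = frobSum s k x + frobSum s k y := by
  simp only [frobSum, add_pow_char_pow, sum_add_distrib]

theorem frobSum_pow (s k j : ℕ) (x : K) : frobSum s k (x ^ 2 ^ j) = frobSum s k x ^ 2 ^ j := by
  rw [frobSum, frobSum, sum_pow_char_pow]
  exact sum_congr rfl fun i _ => by rw [← pow_mul, ← pow_mul, mul_comm]

theorem frobSum_telescope (s k : ℕ) (x : K) :
    frobSum s k (x ^ 2 ^ s + x) = x ^ 2 ^ (s * k) + x := by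
  induction k with
  | zero => simp [frobSum, CharTwo.add_self_eq_zero]
  | succ k ih =>
    rw [frobSum, sum_range_succ, ← frobSum, ih, add_pow_char_pow, ← pow_mul, ← pow_add,
      show s + s * k = s * (k + 1) by ring]
    linear_combination x ^ 2 ^ (s * k) * CharTwo.two_eq_zero (R := K)

/-- Both sides are sums of Frobenius iterates of `y`, once ordered by rows, once by columns. -/
theorem frobSum_one_comm (k l : ℕ) (y : K) :
    frobSum 1 k (y ^ 2 ^ l + y) = frobSum 1 l (y ^ 2 ^ k + y) := by
  have h1 := frobSum_one_add k l y
  have h2 := frobSum_one_add l k y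
  rw [add_comm l k] at h2
  rw [frobSum_add, frobSum_add]
  linear_combination h1 - h2 + (frobSum 1 k y - frobSum 1 l y) * CharTwo.two_eq_zero (R := K)

theorem frobSum_one_two_mul (k : ℕ) (x : K) :
    frobSum 1 (2 * k) x = frobSum 1 k (x ^ 2 ^ k + x) := by
  rw [two_mul, frobSum_one_add, frobSum_add, add_comm]

variable [Fintype K] [DecidableEq K]

omit [CharP K 2] in
theorem card_frobSum_eq_zero_le {s : ℕ} (hs : 0 < s) (k : ℕ) :
    #{x : K | frobSum s (k + 1) x = 0} ≤ 2 ^ (s * k) := by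
  let p : Polynomial K := ∑ i ∈ range (k + 1), Polynomial.X ^ 2 ^ (s * i)
  have hdeg : p.natDegree ≤ 2 ^ (s * k) := by
    refine Polynomial.natDegree_sum_le_of_forall_le _ _ fun i hi => ?_
    rw [Polynomial.natDegree_X_pow]
    exact Nat.pow_le_pow_right two_pos (Nat.mul_le_mul_left _ (by simpa [Nat.lt_succ_iff] using hi))
  have hp : p ≠ 0 := by
    intro h
    have h1 : p.coeff (2 ^ (s * k)) = 0 := by rw [h, Polynomial.coeff_zero]
    have h2 : ∀ i, 2 ^ (s * k) = 2 ^ (s * i) ↔ k = i := fun i => by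
      rw [Nat.pow_right_inj (le_refl 2), Nat.mul_right_inj hs.ne']
    simp only [p, Polynomial.finsetSum_coeff, Polynomial.coeff_X_pow, h2] at h1
    simp at h1
  have hsub : ({x : K | frobSum s (k + 1) x = 0} : Finset K) ⊆ p.roots.toFinset := by
    intro x hx
    rw [mem_filter] at hx
    rw [Multiset.mem_toFinset, Polynomial.mem_roots hp, Polynomial.IsRoot.def]
    simpa [p, Polynomial.eval_finsetSum, frobSum] using hx.2
  exact (card_le_card hsub).trans ((Multiset.toFinset_card_le _).trans
    ((Polynomial.card_roots' p).trans hdeg))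

omit [CharP K 2] in
theorem card_pow_two_pow_eq_self_le {s : ℕ} (hs : 0 < s) :
    #{x : K | x ^ 2 ^ s = x} ≤ 2 ^ s := by
  have h1 : 1 < 2 ^ s := Nat.one_lt_two_pow hs.ne'
  have hp : (Polynomial.X ^ 2 ^ s - Polynomial.X : Polynomial K) ≠ 0 :=
    FiniteField.X_pow_card_sub_X_ne_zero K h1
  have hsub : ({x : K | x ^ 2 ^ s = x} : Finset K) ⊆
      (Polynomial.X ^ 2 ^ s - Polynomial.X : Polynomial K).roots.toFinset := by
    intro x hx
    simpa [Polynomial.mem_roots hp, sub_eq_zero] using hx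
  refine (card_le_card hsub).trans ((Multiset.toFinset_card_le _).trans
    ((Polynomial.card_roots' _).trans ?_))
  rw [FiniteField.X_pow_card_sub_X_natDegree_eq K h1]

/-- A sum over a finite group of a function that factors through a homomorphism. -/
theorem sum_comp_addMonoidHom {G H M : Type*} [AddCommGroup G] [Fintype G] [AddCommGroup H]
    [DecidableEq H] [CommSemiring M] (f : G →+ H) (F : H → M) :
    ∑ x, F (f x) = #{x | f x = 0} * ∑ t ∈ univ.image f, F t := by
  rw [mul_sum, ← sum_fiberwise_of_maps_to (s := univ) (t := univ.image f) (g := f)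
    (fun x _ => mem_image_of_mem _ (mem_univ x))]
  refine sum_congr rfl fun t ht => ?_
  obtain ⟨y, -, rfl⟩ := mem_image.1 ht
  rw [sum_congr rfl (g := fun _ => F (f y)) (fun x hx => by rw [(mem_filter.1 hx).2]),
    sum_const, nsmul_eq_mul]
  congr 2
  refine card_bij (fun x _ => x - y) ?_ ?_ ?_
  · simp +contextual
  · simp
  · exact fun z hz => ⟨z + y, by simpa using hz, by simp⟩

/-- The additive map `x ↦ x ^ (2 ^ s) + x`. -/
def frobAddSelf (K : Type*) [Field K] [CharP K 2] (s : ℕ) : K →+ K where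
  toFun x := x ^ 2 ^ s + x
  map_zero' := by simp
  map_add' x y := by rw [add_pow_char_pow]; ring

/-- Degree bounds give at most 2^s elements in the kernel and at most 2^(s * k) zeros of the
Frobenius sum, which contain the image. Kernel times image is the whole field, so both bounds are
attained. -/
theorem card_frobAddSelf {s k : ℕ} (hs : 0 < s) (hK : Fintype.card K = 2 ^ (s * (k + 1))) :
    #{x : K | x ^ 2 ^ s = x} = 2 ^ s ∧
      univ.image (frobAddSelf K s) = ({x : K | frobSum s (k + 1) x = 0} : Finset K) := by
  have h0 : #{x : K | frobAddSelf K s x = 0} = #{x : K | x ^ 2 ^ s = x} := by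
    congr 1; ext x
    simp only [mem_filter, mem_univ, true_and, frobAddSelf, AddMonoidHom.coe_mk, ZeroHom.coe_mk,
      CharTwo.add_eq_zero]
  have hsum := sum_comp_addMonoidHom (frobAddSelf K s) (fun _ => (1 : ℕ))
  simp only [sum_const, card_univ, smul_eq_mul, mul_one, Nat.cast_id, h0] at hsum
  have hker := card_pow_two_pow_eq_self_le (K := K) hs
  have hle := card_frobSum_eq_zero_le (K := K) hs k
  have hsub : univ.image (frobAddSelf K s) ⊆ ({x : K | frobSum s (k + 1) x = 0} : Finset K) := by
    intro y hy
    obtain ⟨x, -, rfl⟩ := mem_image.1 hy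
    simp only [mem_filter, mem_univ, true_and, frobAddSelf, AddMonoidHom.coe_mk, ZeroHom.coe_mk,
      frobSum_telescope, ← hK, FiniteField.pow_card, CharTwo.add_self_eq_zero]
  have himg := card_le_card hsub
  rw [hK, mul_add, mul_one, pow_add] at hsum
  have hpos1 : 0 < 2 ^ s := by positivity
  have hpos2 : 0 < 2 ^ (s * k) := by positivity
  have e1 : #{x : K | x ^ 2 ^ s = x} = 2 ^ s := by
    by_contra h
    have : #{x : K | x ^ 2 ^ s = x} < 2 ^ s := lt_of_le_of_ne hker h
    nlinarith
  refine ⟨e1, eq_of_subset_of_card_le hsub ?_⟩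
  rw [e1] at hsum
  nlinarith

/-- Additive Hilbert 90 for the Frobenius automorphism of a finite field. -/
theorem exists_pow_add_self_eq_iff {s k : ℕ} (hs : 0 < s) (hk : 0 < k)
    (hK : Fintype.card K = 2 ^ (s * k)) (u : K) :
    (∃ x, x ^ 2 ^ s + x = u) ↔ frobSum s k u = 0 := by
  obtain ⟨k, rfl⟩ := Nat.exists_eq_succ_of_ne_zero hk.ne'
  have := Finset.ext_iff.1 (card_frobAddSelf hs hK).2 u
  simpa [frobAddSelf] using this

theorem card_pow_two_pow_eq_self {s k : ℕ} (hs : 0 < s) (hk : 0 < k)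
    (hK : Fintype.card K = 2 ^ (s * k)) : #{x : K | x ^ 2 ^ s = x} = 2 ^ s := by
  obtain ⟨k, rfl⟩ := Nat.exists_eq_succ_of_ne_zero hk.ne'
  exact (card_frobAddSelf hs hK).1

/-- The trace form of the subfield with `2 ^ k` elements is nondegenerate. -/
theorem eq_zero_of_frobSum_one_mul_eq_zero {k l : ℕ} (hk : 0 < k) (hl : 0 < l)
    (hK : Fintype.card K = 2 ^ (k * l)) (a : K)
    (h : ∀ y : K, y ^ 2 ^ k = y → frobSum 1 k (a * y) = 0) : a = 0 := by
  by_contra ha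
  obtain ⟨k, rfl⟩ := Nat.exists_eq_succ_of_ne_zero hk.ne'
  have h1 := card_frobSum_eq_zero_le (K := K) Nat.one_pos k
  -- Multiplication by `a` embeds the fixed field, with 2^(k+1) elements, into the zeros of a
  -- polynomial of degree 2^k. `a` itself need not lie in that field.
  have h2 : #{x : K | x ^ 2 ^ (k + 1) = x} ≤ #{x : K | frobSum 1 (k + 1) x = 0} :=
    card_le_card_of_injOn (fun y => a * y) (fun y hy => by simpa using h y (by simpa using hy))
      (fun x _ y _ hxy => mul_left_cancel₀ ha hxy)
  rw [card_pow_two_pow_eq_self hk hl hK] at h2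
  have := h2.trans h1
  rw [one_mul, pow_succ] at this
  have hpos : 0 < 2 ^ k := by positivity
  omega

end FrobeniusSums

/-! ### Sums of quadratic characters on finite groups -/

section QuadraticSums

open Finset

variable {G : Type*} [AddCommGroup G] [Fintype G]

theorem sum_eq_zero_of_add_eq_neg {ψ : G → ℤ} (g : G) (h : ∀ x, ψ (x + g) = -ψ x) :
    ∑ x, ψ x = 0 := by
  have h1 : ∑ x, ψ (x + g) = ∑ x, ψ x := Equiv.sum_comp (Equiv.addRight g) ψ
  simp only [h, sum_neg_distrib] at h1
  omega

open scoped Classical in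
theorem sum_sign_character_eq_ite (c : G → ℤ) (hadd : ∀ x y, c (x + y) = c x * c y)
    (hpm : ∀ x, c x = 1 ∨ c x = -1) :
    ∑ x, c x = if ∀ x, c x = 1 then (Fintype.card G : ℤ) else 0 := by
  split_ifs with h
  · simp [h]
  · push Not at h
    obtain ⟨g, hg⟩ := h
    refine sum_eq_zero_of_add_eq_neg g fun x => ?_
    rw [hadd, (hpm g).resolve_left hg, mul_neg_one]

open scoped Classical in
/-- The sum of a quadratic character localizes to the orthogonal complement of any subgroup on
which it is trivial. -/
theorem sum_eq_sum_orthogonal (ψ : G → ℤ) (b : G → G → ℤ)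
    (hb : ∀ x y, ψ (x + y) = ψ x * ψ y * b x y)
    (hadd : ∀ x y z, b x (y + z) = b x y * b x z) (hpm : ∀ x y, b x y = 1 ∨ b x y = -1)
    (H : AddSubgroup G) (hH : ∀ h ∈ H, ψ h = 1) :
    ∑ x, ψ x = ∑ x with (∀ h ∈ H, b x h = 1), ψ x := by
  have h1 : ∑ h : H, ∑ x, ψ (x + h) = Fintype.card H * ∑ x, ψ x := by
    have h (h : H) : ∑ x, ψ (x + h) = ∑ x, ψ x := Equiv.sum_comp (Equiv.addRight (h : G)) ψ
    simp [h]
  -- Averaging over translates by `H`: for fixed `x` the sum over `h` is a character sum, zero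
  -- unless `x` is orthogonal to `H`.
  have h2 : ∑ h : H, ∑ x, ψ (x + h) =
      Fintype.card H * ∑ x with (∀ h ∈ H, b x h = 1), ψ x := by
    rw [sum_comm, sum_filter, mul_sum]
    refine sum_congr rfl fun x _ => ?_
    have := sum_sign_character_eq_ite (fun h : H => b x h) (fun y z => hadd x y z)
      (fun y => hpm x y)
    simp only [hb, hH _ (SetLike.coe_mem _), mul_one, ← mul_sum, this, SetLike.forall]
    split_ifs <;> ring
  have h3 : (Fintype.card H : ℤ) ≠ 0 := by exact_mod_cast Fintype.card_ne_zero
  exact mul_left_cancel₀ h3 (h1.symm.trans h2)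

open scoped Classical in
/-- The square of the sum of a quadratic character is determined by its radical. -/
theorem sq_sum_eq_card_mul_sum_radical (ψ : G → ℤ) (b : G → G → ℤ)
    (hψ : ∀ x, ψ x * ψ x = 1)
    (hb : ∀ x y, ψ (x + y) = ψ x * ψ y * b x y) (hcomm : ∀ x y, b x y = b y x)
    (hadd : ∀ x y z, b x (y + z) = b x y * b x z) (hpm : ∀ x y, b x y = 1 ∨ b x y = -1) :
    (∑ x, ψ x) ^ 2 = Fintype.card G * ∑ h with (∀ x, b h x = 1), ψ h := by
  -- In the double sum over pairs, the second variable is replaced by x + h; summing over x first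
  -- leaves only h in the radical.
  rw [sq, sum_mul_sum, sum_congr rfl fun x _ => (Equiv.sum_comp (Equiv.addLeft x) _).symm,
    sum_comm, sum_filter, mul_sum]
  refine sum_congr rfl fun h _ => ?_
  have h1 : ∀ x, ψ x * ψ (Equiv.addLeft x h) = ψ h * b h x := fun x => by
    rw [Equiv.coe_addLeft, hb, hcomm h x]
    linear_combination ψ h * b x h * hψ x
  simp only [h1, ← mul_sum]
  rw [sum_sign_character_eq_ite (fun x => b h x) (fun y z => hadd h y z) (fun y => hpm h y)]
  split_ifs <;> ring

end QuadraticSums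

/-! ### The additive character given by the absolute trace -/

section TraceSign

open Finset

variable {K : Type*} [Field K]

open scoped Classical in
/-- The sign `(-1) ^ Tr x`, with `Tr` the absolute trace of the field with `2 ^ N` elements. -/
noncomputable def traceSign (N : ℕ) (x : K) : ℤ := if frobSum 1 N x = 0 then 1 else -1

theorem traceSign_eq_one_or (N : ℕ) (x : K) : traceSign N x = 1 ∨ traceSign N x = -1 := by
  unfold traceSign; split_ifs <;> simp

theorem traceSign_mul_self (N : ℕ) (x : K) : traceSign N x * traceSign N x = 1 := by
  rcases traceSign_eq_one_or N x with h | h <;> rw [h] <;> rfl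

theorem traceSign_eq_one_iff (N : ℕ) (x : K) : traceSign N x = 1 ↔ frobSum 1 N x = 0 := by
  unfold traceSign; split_ifs with h <;> simp [h]

variable [CharP K 2]

theorem traceSign_pow (N j : ℕ) (x : K) : traceSign N (x ^ 2 ^ j) = traceSign N x := by
  unfold traceSign
  rw [frobSum_pow]
  by_cases h : frobSum 1 N x = 0 <;> simp [h]

variable [Fintype K] {N : ℕ}

theorem frobSum_one_eq_zero_or_one (hK : Fintype.card K = 2 ^ N) (x : K) :
    frobSum 1 N x = 0 ∨ frobSum 1 N x = 1 := by
  have h := frobSum_telescope 1 N x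
  rw [one_mul, ← hK, FiniteField.pow_card, CharTwo.add_self_eq_zero, frobSum_add, frobSum_pow,
    pow_one] at h
  have h2 : frobSum 1 N x * (frobSum 1 N x - 1) = 0 := by
    linear_combination h - frobSum 1 N x * CharTwo.two_eq_zero (R := K)
  rcases mul_eq_zero.1 h2 with h | h
  · exact Or.inl h
  · exact Or.inr (sub_eq_zero.1 h)

theorem traceSign_add (hK : Fintype.card K = 2 ^ N) (x y : K) :
    traceSign N (x + y) = traceSign N x * traceSign N y := by
  unfold traceSign
  rw [frobSum_add]
  rcases frobSum_one_eq_zero_or_one hK x with h | h <;>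
    rcases frobSum_one_eq_zero_or_one hK y with h' | h' <;>
    simp [h, h', CharTwo.add_self_eq_zero]

/-- The number of solutions of an Artin–Schreier equation. -/
theorem card_sq_add_self_eq [DecidableEq K] (hN : 0 < N) (hK : Fintype.card K = 2 ^ N) (t : K) :
    (#{y : K | y ^ 2 + y = t} : ℤ) = 1 + traceSign N t := by
  have h := exists_pow_add_self_eq_iff Nat.one_pos hN (by rwa [one_mul]) t
  rw [pow_one, ← traceSign_eq_one_iff] at h
  rcases traceSign_eq_one_or N t with ht | ht
  · obtain ⟨y, rfl⟩ := h.2 ht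
    have : ({z : K | z ^ 2 + z = y ^ 2 + y} : Finset K) = {y, y + 1} := by
      ext z
      simp only [mem_filter, mem_univ, true_and, mem_insert, mem_singleton]
      have e : z ^ 2 + z - (y ^ 2 + y) = (z - y) * (z - (y + 1)) := by
        linear_combination (z - y + z * y - y ^ 2) * CharTwo.two_eq_zero (R := K)
      rw [← sub_eq_zero, e, mul_eq_zero, sub_eq_zero, sub_eq_zero]
    rw [this, card_pair (by simp), ht]; rfl
  · rw [ht, card_eq_zero.2]; rfl
    refine filter_eq_empty_iff.2 fun y _ hy => ?_
    rw [h.1 ⟨y, hy⟩] at ht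
    norm_num at ht

end TraceSign

/-! ### The quadratic form of the curve and its polar form -/

section CurveSum

open Finset

variable {K : Type*} [Field K]

/-- The right-hand side of the affine equation of the curve. -/
def curveFun (r : ℕ) (a x : K) : K := a * (x ^ (2 ^ (r + 1) + 1) + x ^ (2 ^ r + 2))

/-- The quadratic character whose sum counts the points of the curve. -/
noncomputable def curveSign (r N : ℕ) (a x : K) : ℤ := traceSign N (curveFun r a x)

/-- The operator representing the polar form of the quadratic form `Tr (curveFun r a x)`. -/
def polarMap (r : ℕ) (a x : K) : K :=
  a ^ 2 * (x ^ 2 ^ (2 * r) + x) ^ 4 + a * (x ^ 2 ^ (2 * r) + x)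

theorem pow_two_pow_succ (x : K) (r : ℕ) : x ^ 2 ^ (r + 1) = (x ^ 2 ^ r) ^ 2 := by
  rw [pow_succ, pow_mul]

/-- On F_q both exponents 2q + 1 and q + 2 act as 3. This is why cubes in F_q and cube roots of
unity decide the answer. -/
theorem curveFun_mul {r : ℕ} {c : K} (hc : c ^ 2 ^ r = c) (a x : K) :
    curveFun r a (c * x) = curveFun r (a * c ^ 3) x := by
  have e1 : c ^ (2 ^ (r + 1) + 1) = c ^ 3 := by rw [pow_succ, pow_two_pow_succ, hc]; ring
  have e2 : c ^ (2 ^ r + 2) = c ^ 3 := by rw [pow_add, hc]; ring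
  rw [curveFun, mul_pow, mul_pow, e1, e2, curveFun]
  ring

variable [CharP K 2]

theorem curveFun_add (r : ℕ) (a x y : K) :
    curveFun r a (x + y) = curveFun r a x + curveFun r a y +
      a * (x ^ 2 ^ (r + 1) * y + y ^ 2 ^ (r + 1) * x + x ^ 2 ^ r * y ^ 2 + y ^ 2 ^ r * x ^ 2) := by
  unfold curveFun
  simp only [pow_succ _ (2 ^ (r + 1)), pow_add _ (2 ^ r) 2, add_pow_char_pow]
  linear_combination a * (x * y * (x ^ 2 ^ r + y ^ 2 ^ r)) * CharTwo.two_eq_zero (R := K)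

variable {r N : ℕ} {a : K} [Fintype K]

/-- The trace is Frobenius invariant, so each of the four terms may be raised to the power of 2 that
turns its `y` into y^(2q): 2q, 1, q and 2 respectively. -/
theorem traceSign_polar (hK : Fintype.card K = 2 ^ N) (ha : a ^ 2 ^ r = a) (x y : K) :
    traceSign N (a * (x ^ 2 ^ (r + 1) * y + y ^ 2 ^ (r + 1) * x + x ^ 2 ^ r * y ^ 2 +
      y ^ 2 ^ r * x ^ 2)) = traceSign N (y ^ 2 ^ (r + 1) * polarMap r a x) := by
  have e : (x ^ 2 ^ r) ^ 2 ^ r = x ^ 2 ^ (2 * r) := by rw [← pow_mul, ← pow_add, two_mul]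
  have h1 := traceSign_pow N (r + 1) (a * x ^ 2 ^ (r + 1) * y)
  have h2 := traceSign_pow N r (a * x ^ 2 ^ r * y ^ 2)
  have h3 := traceSign_pow N 1 (a * y ^ 2 ^ r * x ^ 2)
  have f1 : (a * x ^ 2 ^ (r + 1) * y) ^ 2 ^ (r + 1) =
      y ^ 2 ^ (r + 1) * (a ^ 2 * (x ^ 2 ^ (2 * r)) ^ 4) := by
    simp only [pow_two_pow_succ, mul_pow, ha, pow_right_comm _ 2 (2 ^ r), e]; ring
  have f2 : (a * x ^ 2 ^ r * y ^ 2) ^ 2 ^ r = y ^ 2 ^ (r + 1) * (a * x ^ 2 ^ (2 * r)) := by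
    simp only [pow_two_pow_succ, mul_pow, ha, pow_right_comm _ 2 (2 ^ r), e]; ring
  have f3 : (a * y ^ 2 ^ r * x ^ 2) ^ 2 ^ 1 = y ^ 2 ^ (r + 1) * (a ^ 2 * x ^ 4) := by
    simp only [pow_two_pow_succ, pow_one]; ring
  rw [f1] at h1; rw [f2] at h2; rw [f3] at h3
  have g1 : a * (x ^ 2 ^ (r + 1) * y + y ^ 2 ^ (r + 1) * x + x ^ 2 ^ r * y ^ 2 +
      y ^ 2 ^ r * x ^ 2) = a * x ^ 2 ^ (r + 1) * y + y ^ 2 ^ (r + 1) * (a * x) +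
        a * x ^ 2 ^ r * y ^ 2 + a * y ^ 2 ^ r * x ^ 2 := by ring
  have g2 : y ^ 2 ^ (r + 1) * polarMap r a x = y ^ 2 ^ (r + 1) * (a ^ 2 * (x ^ 2 ^ (2 * r)) ^ 4)
      + y ^ 2 ^ (r + 1) * (a * x) + y ^ 2 ^ (r + 1) * (a * x ^ 2 ^ (2 * r)) +
        y ^ 2 ^ (r + 1) * (a ^ 2 * x ^ 4) := by
    have : (x ^ 2 ^ (2 * r) + x) ^ 4 = (x ^ 2 ^ (2 * r)) ^ 4 + x ^ 4 := by
      have := add_pow_char_pow (p := 2) (n := 2) (x ^ 2 ^ (2 * r)) x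
      norm_num at this; exact this
    rw [polarMap, this]; ring
  rw [g1, g2]
  simp only [traceSign_add hK, h1, h2, h3]

theorem curveSign_add (hK : Fintype.card K = 2 ^ N) (ha : a ^ 2 ^ r = a) (x y : K) :
    curveSign r N a (x + y) = curveSign r N a x * curveSign r N a y *
      traceSign N (y ^ 2 ^ (r + 1) * polarMap r a x) := by
  rw [curveSign, curveFun_add, traceSign_add hK, traceSign_add hK, traceSign_polar hK ha]; rfl

theorem traceSign_polar_comm (hK : Fintype.card K = 2 ^ N) (ha : a ^ 2 ^ r = a) (x y : K) :
    traceSign N (y ^ 2 ^ (r + 1) * polarMap r a x) =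
      traceSign N (x ^ 2 ^ (r + 1) * polarMap r a y) := by
  rw [← traceSign_polar hK ha, ← traceSign_polar hK ha]
  congr 1; ring

theorem traceSign_polar_add (hK : Fintype.card K = 2 ^ N) (x y z : K) :
    traceSign N ((y + z) ^ 2 ^ (r + 1) * polarMap r a x) =
      traceSign N (y ^ 2 ^ (r + 1) * polarMap r a x) *
        traceSign N (z ^ 2 ^ (r + 1) * polarMap r a x) := by
  rw [add_pow_char_pow, add_mul, traceSign_add hK]

omit [CharP K 2] [Fintype K] in
/-- The Frobenius map is bijective on each subfield. -/
theorem exists_pow_two_pow_eq_of_fixed {k : ℕ} (hk : 0 < k) (j : ℕ) (y : K) (hy : y ^ 2 ^ k = y) :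
    ∃ z : K, z ^ 2 ^ k = z ∧ z ^ 2 ^ j = y := by
  obtain ⟨k, rfl⟩ := Nat.exists_eq_succ_of_ne_zero hk.ne'
  refine ⟨y ^ 2 ^ (k * j), ?_, ?_⟩
  · rw [← pow_mul, mul_comm, pow_mul, hy]
  · rw [← pow_mul, ← pow_add, ← Nat.succ_mul, pow_two_pow_mul_of_fixed hy]

theorem sq_sum_curveSign [DecidableEq K] (hN : 0 < N) (hK : Fintype.card K = 2 ^ N) (ha : a ^ 2 ^ r = a) :
    (∑ x, curveSign r N a x) ^ 2 = 2 ^ N * ∑ x with polarMap r a x = 0, curveSign r N a x := by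
  rw [sq_sum_eq_card_mul_sum_radical (curveSign r N a)
    (fun x y => traceSign N (y ^ 2 ^ (r + 1) * polarMap r a x)) (fun x => traceSign_mul_self _ _)
    (curveSign_add hK ha) (traceSign_polar_comm hK ha) (traceSign_polar_add hK)
    (fun x y => traceSign_eq_one_or _ _), hK]
  push_cast
  congr 1
  refine sum_congr (Finset.ext fun x => ?_) fun _ _ => rfl
  simp only [mem_filter, mem_univ, true_and]
  refine ⟨fun h => ?_, fun h y => ?_⟩
  -- The power y^(2q) runs over all of `K`, so nondegeneracy of the trace form identifies the
  -- radical with the kernel of `polarMap`.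
  · refine eq_zero_of_frobSum_one_mul_eq_zero hN Nat.one_pos (by rwa [mul_one]) _ fun y hy => ?_
    obtain ⟨z, -, rfl⟩ := exists_pow_two_pow_eq_of_fixed hN (r + 1) y hy
    rw [mul_comm, ← traceSign_eq_one_iff]; exact h z
  · rw [h, mul_zero, traceSign_eq_one_iff, frobSum_zero]

end CurveSum

/-! ### Extensions of even degree n = 2m -/

section EvenDegree

open Finset

variable {K : Type*} [Field K] [CharP K 2] {r m : ℕ} {a : K}

theorem frobAddSelf_apply (s : ℕ) (x : K) : frobAddSelf K s x = x ^ 2 ^ s + x := rfl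

theorem add_pow_four (x y : K) : (x + y) ^ 4 = x ^ 4 + y ^ 4 := by
  have := add_pow_char_pow (p := 2) (n := 2) x y
  norm_num at this; exact this

theorem polarMap_add (r : ℕ) (a x y : K) :
    polarMap r a (x + y) = polarMap r a x + polarMap r a y := by
  simp only [polarMap, add_pow_char_pow, add_pow_four]; ring

theorem polarMap_pow {M : ℕ} (ha : a ^ 2 ^ M = a) (x : K) :
    polarMap r a x ^ 2 ^ M = polarMap r a (x ^ 2 ^ M) := by
  simp only [polarMap, add_pow_char_pow, mul_pow, pow_right_comm _ _ (2 ^ M), ha]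

theorem curveFun_pow {M : ℕ} (ha : a ^ 2 ^ M = a) (x : K) :
    curveFun r a x ^ 2 ^ M = curveFun r a (x ^ 2 ^ M) := by
  simp only [curveFun, add_pow_char_pow, mul_pow, pow_right_comm _ _ (2 ^ M), ha]

/-- The kernel of the trace on the roots of `a * T ^ 4 = T`. -/
noncomputable def traceZeroRoots [Fintype K] [DecidableEq K] (r k : ℕ) (a : K) : Finset K :=
  {T | a * T ^ 4 = T ∧ frobSum r k T = 0}

theorem pow_eq_self_of_frobSum_eq_zero {r k : ℕ} {T : K} (h : frobSum r k T = 0) :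
    T ^ 2 ^ (r * k) = T := by
  have h1 := frobSum_telescope r k T
  rw [frobSum_add, frobSum_pow, h, add_zero, zero_pow (by positivity), eq_comm] at h1
  exact CharTwo.add_eq_zero.1 h1

variable [Fintype K]

/-- `x ↦ v ^ q + v` with `v = x ^ (q ^ m) + x` and `q = 2 ^ r`. -/
def doubleTrace (K : Type*) [Field K] [CharP K 2] (r m : ℕ) : K →+ K :=
  (frobAddSelf K r).comp (frobAddSelf K (r * m))

theorem pow_frobAddSelf_eq (hK : Fintype.card K = 2 ^ (2 * (r * m))) (x : K) :
    frobAddSelf K (r * m) x ^ 2 ^ (r * m) = frobAddSelf K (r * m) x := by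
  rw [frobAddSelf_apply, add_pow_char_pow, ← pow_mul, ← pow_add, ← two_mul, ← hK,
    FiniteField.pow_card, add_comm]

/-- Put v = x^(q^m) + x, so that v^q = v + T. Pairing conjugates over F_(q^m) leaves the sum over r
* m iterates of f(x + v) + f(x). `hdecomp` writes this as a sum of terms z^q + z and z^2 + z, and
`frobSum_one_comm` trades each for a short sum in z^(q^m) + z, computed in `k1` to `k5`. -/
theorem frobSum_curveFun (hK : Fintype.card K = 2 ^ (2 * (r * m))) (ha : a ^ 2 ^ r = a)
    {x T : K} (hx : doubleTrace K r m x = T) (hT : a * T ^ 4 = T) :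
    frobSum 1 (2 * (r * m)) (curveFun r a x) = a * T ^ 3 := by
  have haM := pow_two_pow_mul_of_fixed ha m
  have hvM := pow_frobAddSelf_eq hK x
  have hv : x ^ 2 ^ (r * m) = x + frobAddSelf K (r * m) x := by
    rw [frobAddSelf_apply]; linear_combination -x * CharTwo.two_eq_zero (R := K)
  have hv' : frobAddSelf K (r * m) x ^ 2 ^ r = frobAddSelf K (r * m) x + T := by
    rw [← hx, doubleTrace, AddMonoidHom.comp_apply, frobAddSelf_apply r]
    linear_combination -frobAddSelf K (r * m) x * CharTwo.two_eq_zero (R := K)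
  generalize frobAddSelf K (r * m) x = v at hvM hv hv'
  have hTM : T ^ 2 ^ (r * m) = T := by
    have h1 : v ^ 2 ^ r + v = T := by
      rw [hv']; linear_combination v * CharTwo.two_eq_zero (R := K)
    rw [← h1, add_pow_char_pow, pow_right_comm, hvM]
  have hTT : a ^ 2 * T ^ 4 = a * T := by linear_combination a * hT
  obtain ⟨X, hX⟩ : ∃ X, X = x ^ 2 ^ r := ⟨_, rfl⟩
  have hdecomp : curveFun r a v + a * (x ^ 2 ^ (r + 1) * v + v ^ 2 ^ (r + 1) * x + X * v ^ 2 +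
      v ^ 2 ^ r * x ^ 2) =
      ((a * v * x ^ 2) ^ 2 ^ r + a * v * x ^ 2) + ((a * v ^ 2 * x) ^ 2 ^ r + a * v ^ 2 * x) +
      ((a * T ^ 2 * x) ^ 2 ^ 1 + a * T ^ 2 * x) + ((a * T ^ 2 * X) ^ 2 ^ 1 + a * T ^ 2 * X) +
      ((a * T ^ 2 * v) ^ 2 ^ 1 + a * T ^ 2 * v) := by
    have e1 : (v + T) ^ 2 = v ^ 2 + T ^ 2 := CharTwo.add_sq v T
    have e2 : x ^ (2 ^ r * 2) = X ^ 2 := by rw [pow_mul, hX]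
    have e3 : v ^ (2 ^ r * 2) = v ^ 2 + T ^ 2 := by rw [pow_mul, hv', e1]
    have e4 : v ^ (2 ^ (r + 1) + 1) = (v ^ 2 + T ^ 2) * v := by rw [pow_succ, pow_succ 2 r, e3]
    have e5 : v ^ (2 ^ r + 2) = (v + T) * v ^ 2 := by rw [pow_add, hv']
    rw [curveFun, e4, e5]
    simp only [pow_succ 2 r, e2, e3, pow_one, mul_pow, ha,
      pow_right_comm _ 2 (2 ^ r), ← hX, hv', e1]
    linear_combination (-x ^ 2 - X ^ 2 - v ^ 2) * hTT +
      (a * v ^ 3 - a * T * X ^ 2 - a * T ^ 2 * X) * CharTwo.two_eq_zero (R := K)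
  have k1 : (a * v * x ^ 2) ^ 2 ^ (r * m) + a * v * x ^ 2 = a * v ^ 3 := by
    rw [mul_pow, mul_pow, pow_right_comm x, haM, hvM, hv]
    linear_combination (a * v * x ^ 2 + a * v ^ 2 * x) * CharTwo.two_eq_zero (R := K)
  have k2 : (a * v ^ 2 * x) ^ 2 ^ (r * m) + a * v ^ 2 * x = a * v ^ 3 := by
    rw [mul_pow, mul_pow, pow_right_comm v, haM, hvM, hv]
    linear_combination (a * v ^ 2 * x) * CharTwo.two_eq_zero (R := K)
  have k3 : (a * T ^ 2 * x) ^ 2 ^ (r * m) + a * T ^ 2 * x = a * T ^ 2 * v := by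
    rw [mul_pow, mul_pow, pow_right_comm T, haM, hTM, hv]
    linear_combination (a * T ^ 2 * x) * CharTwo.two_eq_zero (R := K)
  have k4 : (a * T ^ 2 * X) ^ 2 ^ (r * m) + a * T ^ 2 * X = a * T ^ 2 * (v + T) := by
    rw [mul_pow, mul_pow, pow_right_comm T, haM, hTM, hX, pow_right_comm x, hv, add_pow_char_pow,
      hv']
    linear_combination (a * T ^ 2 * x ^ 2 ^ r) * CharTwo.two_eq_zero (R := K)
  have k5 : (a * T ^ 2 * v) ^ 2 ^ (r * m) + a * T ^ 2 * v = 0 := by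
    rw [mul_pow, mul_pow, pow_right_comm T, haM, hTM, hvM, CharTwo.add_self_eq_zero]
  have one (y : K) : frobSum 1 1 y = y := by simp [frobSum]
  rw [frobSum_one_two_mul, curveFun_pow haM, hv, curveFun_add]
  rw [show ∀ A B C : K, A + B + C + A = B + C from fun A B C => by
    linear_combination A * CharTwo.two_eq_zero (R := K), ← hX, hdecomp]
  simp only [frobSum_add _ _ (_ + _) (_ + _), frobSum_one_comm (r * m), k1, k2, k3, k4, k5, one]
  -- The contributions of `k1` and `k2` coincide and cancel; `k3` and `k4` add up to aT^3.
  linear_combination (frobSum 1 r (a * v ^ 3) + a * T ^ 2 * v) * CharTwo.two_eq_zero (R := K)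

omit [Fintype K] in
-- With f = y^(q^m) + y in F_q and `polarMap r a x` in F_(q^m), pairing conjugates leaves f^2 times
-- `polarMap r a x`, which is z^(q^2) + z for z = f^2(a^2 x^4 + ax). Exchanging the two Frobenius
-- sums then replaces x by v, and pairing again replaces v by T.
theorem frobSum_polar (ha : a ^ 2 ^ r = a)
    {x T : K} (hx : doubleTrace K r m x = T)
    (hw : polarMap r a x ^ 2 ^ (r * m) = polarMap r a x) {y : K}
    (hy : doubleTrace K r m y = 0) :
    frobSum 1 (2 * (r * m)) (y ^ 2 ^ (r + 1) * polarMap r a x) =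
      frobSum 1 r ((a ^ 2 * T ^ 4 + a * T) * frobAddSelf K (r * m) y ^ 2) := by
  have haM := pow_two_pow_mul_of_fixed ha m
  set f := frobAddSelf K (r * m) y with hf
  have hfr : f ^ 2 ^ r = f := by
    rw [doubleTrace, AddMonoidHom.comp_apply, frobAddSelf_apply r] at hy
    exact CharTwo.add_eq_zero.1 hy
  set v := frobAddSelf K (r * m) x with hv
  have hT : v ^ 2 ^ r + v = T := hx
  have e1 : (y ^ 2 ^ (r + 1) * polarMap r a x) ^ 2 ^ (r * m) + y ^ 2 ^ (r + 1) * polarMap r a x =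
      (f ^ 2 * (a ^ 2 * x ^ 4 + a * x)) ^ 2 ^ (2 * r) + f ^ 2 * (a ^ 2 * x ^ 4 + a * x) := by
    have hf2 : f ^ 2 ^ (r + 1) = f ^ 2 := by rw [pow_two_pow_succ, hfr]
    have hf3 : f ^ 2 ^ (2 * r) = f := by rw [mul_comm]; exact pow_two_pow_mul_of_fixed hfr 2
    have ha3 : a ^ 2 ^ (2 * r) = a := by rw [mul_comm]; exact pow_two_pow_mul_of_fixed ha 2
    rw [mul_pow, hw, ← add_mul, pow_right_comm, ← add_pow_char_pow, ← frobAddSelf_apply, ← hf, hf2,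
      mul_pow, add_pow_char_pow, mul_pow, mul_pow]
    simp only [pow_right_comm _ _ (2 ^ (2 * r)), hf3, ha3]
    rw [polarMap, add_pow_four]
    ring
  have e2 : (f ^ 2 * (a ^ 2 * x ^ 4 + a * x)) ^ 2 ^ (r * m) + f ^ 2 * (a ^ 2 * x ^ 4 + a * x) =
      f ^ 2 * (a ^ 2 * v ^ 4 + a * v) := by
    rw [mul_pow, add_pow_char_pow, mul_pow, mul_pow, hv, frobAddSelf_apply, add_pow_four]
    simp only [pow_right_comm _ _ (2 ^ (r * m)), haM, pow_two_pow_mul_of_fixed hfr]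
    ring
  rw [frobSum_one_two_mul, e1, frobSum_one_comm, e2, frobSum_one_two_mul]
  congr 1
  rw [mul_pow, add_pow_char_pow, mul_pow, mul_pow, ← hT, add_pow_four]
  simp only [pow_right_comm _ _ (2 ^ r), ha, hfr]
  ring

theorem orthogonal_iff (hr : 0 < r) (hm : 0 < m) (hK : Fintype.card K = 2 ^ (2 * (r * m)))
    (ha : a ^ 2 ^ r = a) (ha0 : a ≠ 0) (x : K) :
    (∀ y ∈ (doubleTrace K r m).ker,
      traceSign (2 * (r * m)) (y ^ 2 ^ (r + 1) * polarMap r a x) = 1) ↔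
      a * doubleTrace K r m x ^ 4 = doubleTrace K r m x := by
  classical
  have haM := pow_two_pow_mul_of_fixed ha m
  simp only [traceSign_eq_one_iff, AddMonoidHom.mem_ker]
  have hM : 0 < r * m := by positivity
  set T := doubleTrace K r m x with hT
  have hs : a ^ 2 * T ^ 4 + a * T = 0 ↔ a * T ^ 4 = T := by
    rw [CharTwo.add_eq_zero, sq, mul_assoc]
    exact mul_right_inj' ha0
  have hwv : polarMap r a x ^ 2 ^ (r * m) + polarMap r a x =
      polarMap r a (frobAddSelf K (r * m) x) := by
    rw [polarMap_pow haM, ← polarMap_add, frobAddSelf_apply]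
  constructor
  · intro h
    -- Testing only against F_(q^m), which lies in the kernel of `doubleTrace`, already puts
    -- `polarMap r a x` in F_(q^m), as `frobSum_polar` requires.
    have hp : polarMap r a (frobAddSelf K (r * m) x) = 0 := by
      refine eq_zero_of_frobSum_one_mul_eq_zero (l := 2) hM Nat.two_pos (by rw [hK, mul_comm]) _
        fun y hy => ?_
      obtain ⟨z, hz, rfl⟩ := exists_pow_two_pow_eq_of_fixed hM (r + 1) y hy
      have := h z (by rw [doubleTrace, AddMonoidHom.comp_apply, frobAddSelf_apply (r * m), hz,
        CharTwo.add_self_eq_zero, map_zero])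
      rw [frobSum_one_two_mul, mul_pow, hy, ← mul_add, hwv] at this
      rw [mul_comm (polarMap _ _ _)]
      exact this
    rw [hp, CharTwo.add_eq_zero] at hwv
    rw [← hs]
    refine eq_zero_of_frobSum_one_mul_eq_zero (k := r) (l := m * 2) hr (by positivity)
      (by rw [hK]; ring_nf) _ fun f hf => ?_
    obtain ⟨f, hf', rfl⟩ := exists_pow_two_pow_eq_of_fixed hr 1 f hf
    obtain ⟨y, hy⟩ := (exists_pow_add_self_eq_iff hM Nat.two_pos (by rw [hK, mul_comm]) f).2 (by
      simp [frobSum, sum_range_succ, pow_two_pow_mul_of_fixed hf', CharTwo.add_self_eq_zero])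
    have hy' : doubleTrace K r m y = 0 := by
      rw [doubleTrace, AddMonoidHom.comp_apply, frobAddSelf_apply (r * m), hy, frobAddSelf_apply,
        hf', CharTwo.add_self_eq_zero]
    have := h y hy'
    rwa [frobSum_polar ha hT.symm hwv hy', frobAddSelf_apply, hy] at this
  · intro h y hy
    rw [← hs] at h
    rw [frobSum_polar ha hT.symm _ hy, h, zero_mul, frobSum_zero]
    rw [← CharTwo.add_eq_zero, hwv]
    -- Hence `polarMap` at v is s^q + s with s = a^2 T^4 + aT, and s = 0.
    have e : frobAddSelf K (r * m) x ^ 2 ^ (2 * r) + frobAddSelf K (r * m) x = T ^ 2 ^ r + T := by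
      rw [hT, doubleTrace, AddMonoidHom.comp_apply, frobAddSelf_apply r, add_pow_char_pow,
        ← pow_mul, ← pow_add, ← two_mul]
      linear_combination
        -(frobAddSelf K (r * m) x ^ 2 ^ r) * CharTwo.two_eq_zero (R := K)
    have e2 := congrArg (· ^ 2 ^ r) h
    simp only [add_pow_char_pow, mul_pow, pow_right_comm _ _ (2 ^ r), ha] at e2
    rw [zero_pow (by positivity)] at e2
    rw [polarMap, e, add_pow_four]
    linear_combination e2 + h

variable [DecidableEq K]

/-- If t = v^q + v, its sum of m iterates telescopes to v^(q^m) + v, which vanishes exactly when v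
lies in F_(q^m), the image of x ↦ x^(q^m) + x. -/
theorem mem_image_doubleTrace_iff (hr : 0 < r) (hm : 0 < m)
    (hK : Fintype.card K = 2 ^ (2 * (r * m))) (t : K) :
    t ∈ univ.image (doubleTrace K r m) ↔ frobSum r m t = 0 := by
  have hM : 0 < r * m := by positivity
  simp only [mem_image, mem_univ, true_and]
  constructor
  · rintro ⟨x, rfl⟩
    rw [doubleTrace, AddMonoidHom.comp_apply, frobAddSelf_apply r, frobSum_telescope,
      pow_frobAddSelf_eq hK, CharTwo.add_self_eq_zero]
  · intro h
    have hK' : Fintype.card K = 2 ^ (r * (m + m)) := by rw [hK]; ring_nf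
    obtain ⟨v, rfl⟩ := (exists_pow_add_self_eq_iff hr (by positivity) hK' t).2 (by
      rw [frobSum, sum_range_add]
      simp only [mul_add r m, pow_add 2 (r * m), pow_mul t,
        pow_eq_self_of_frobSum_eq_zero h, CharTwo.add_self_eq_zero])
    rw [frobSum_telescope] at h
    obtain ⟨x, rfl⟩ := (exists_pow_add_self_eq_iff hM Nat.two_pos (by rw [hK, mul_comm]) v).2 (by
      simpa [frobSum, sum_range_succ, add_comm] using h)
    exact ⟨x, rfl⟩

/-- The kernel is the preimage of F_q under x ↦ x^(q^m) + x; F_q lies in the image and every fibre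
has q^m elements. -/
theorem card_ker_doubleTrace (hr : 0 < r) (hm : 0 < m)
    (hK : Fintype.card K = 2 ^ (2 * (r * m))) :
    #{x | doubleTrace K r m x = 0} = 2 ^ (r * (m + 1)) := by
  have hM : 0 < r * m := by positivity
  have h := sum_comp_addMonoidHom (frobAddSelf K (r * m))
    (fun v => if v ^ 2 ^ r = v then 1 else 0)
  have h1 : #{x | frobAddSelf K (r * m) x = 0} = 2 ^ (r * m) := by
    rw [← card_pow_two_pow_eq_self hM Nat.two_pos (by rw [hK, mul_comm])]
    congr 1; ext x; simp [frobAddSelf_apply, CharTwo.add_eq_zero]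
  have h2 : ({v ∈ univ.image (frobAddSelf K (r * m)) | v ^ 2 ^ r = v} : Finset K) =
      ({v | v ^ 2 ^ r = v} : Finset K) := by
    ext v
    simp only [mem_filter, mem_image, mem_univ, true_and, and_iff_right_iff_imp]
    intro hv
    refine (exists_pow_add_self_eq_iff hM Nat.two_pos (by rw [hK, mul_comm]) v).2 ?_
    simp [frobSum, sum_range_succ, pow_two_pow_mul_of_fixed hv, CharTwo.add_self_eq_zero]
  rw [← sum_filter, ← sum_filter, h2, h1, sum_const, sum_const, smul_eq_mul, smul_eq_mul, mul_one,
    mul_one, card_pow_two_pow_eq_self (k := 2 * m) hr (by positivity) (by rw [hK]; ring_nf),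
    Nat.cast_id, ← pow_add] at h
  rw [mul_add, mul_one, ← h]
  refine congrArg card (filter_congr fun x _ => ?_)
  rw [doubleTrace, AddMonoidHom.comp_apply, frobAddSelf_apply r, CharTwo.add_eq_zero]

/-- The exact value of the exponential sum over an extension of even degree. -/
theorem sum_curveSign_even (hr : 0 < r) (hm : 0 < m) (hK : Fintype.card K = 2 ^ (2 * (r * m)))
    (ha : a ^ 2 ^ r = a) (ha0 : a ≠ 0) :
    ∑ x, curveSign r (2 * (r * m)) a x =
      2 ^ (r * (m + 1)) * (2 - #(traceZeroRoots r m a) : ℤ) := by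
  have hval (x T : K) (hx : doubleTrace K r m x = T) (hT : a * T ^ 4 = T) :
      curveSign r (2 * (r * m)) a x = if T = 0 then 1 else -1 := by
    rw [curveSign, traceSign, frobSum_curveFun hK ha hx hT]
    by_cases h : T = 0 <;> simp [h, ha0]
  rw [sum_eq_sum_orthogonal (curveSign r (2 * (r * m)) a)
    (fun x y => traceSign _ (y ^ 2 ^ (r + 1) * polarMap r a x)) (curveSign_add hK ha)
    (traceSign_polar_add hK) (fun _ _ => traceSign_eq_one_or _ _) (doubleTrace K r m).ker
    (fun x hx => by rw [hval x 0 hx (by simp)]; simp)]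
  simp only [orthogonal_iff hr hm hK ha ha0]
  -- The summand depends only on T, so each admissible T counts |ker| times: +1 for T = 0 and -1 for
  -- every other root.
  have hF := sum_comp_addMonoidHom (doubleTrace K r m) (fun T => if a * T ^ 4 = T then
    (if T = 0 then (1 : ℤ) else -1) else 0)
  rw [card_ker_doubleTrace hr hm hK, ← sum_filter, ← sum_filter] at hF
  rw [sum_congr rfl fun x hx => hval x _ rfl (mem_filter.1 hx).2]
  have hset : ({T ∈ univ.image (doubleTrace K r m) | a * T ^ 4 = T} : Finset K) =
      traceZeroRoots r m a := by
    ext T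
    rw [mem_filter, mem_image_doubleTrace_iff hr hm hK, traceZeroRoots, mem_filter]
    simp [and_comm]
  have h0 : (0 : K) ∈ traceZeroRoots r m a := by simp [traceZeroRoots, frobSum_zero]
  have hsum : ∑ T ∈ traceZeroRoots r m a, (if T = 0 then (1 : ℤ) else -1) =
      2 - #(traceZeroRoots r m a) := by
    rw [← add_sum_erase _ _ h0, sum_congr rfl (g := fun _ => (-1 : ℤ)) (fun T hT => by
      rw [if_neg (ne_of_mem_erase hT)]), sum_const, nsmul_eq_mul, if_pos rfl,
      ← card_erase_add_one h0]
    push_cast; ring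
  rw [hset, hsum] at hF
  push_cast at hF
  exact hF

end EvenDegree

/-! ### Extensions of odd degree -/

section OddDegree

open Finset

/-- A sum of an invariant function is congruent modulo `p` to its sum over the fixed points of a
transformation of order `p`. -/
theorem sum_modEq_sum_fixed {G : Type*} [Fintype G] [DecidableEq G] {p : ℕ} [Fact p.Prime]
    (f : G → G) (hf : f^[p] = id) (ψ : G → ℤ) (hψ : ∀ x, ψ (f x) = ψ x) :
    ∑ x, ψ x ≡ ∑ x with f x = x, ψ x [ZMOD p] := by
  -- Each level set of `ψ` is permuted by `f`, so fixed points are counted level by level.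
  have key (c : ℤ) : #{x | ψ x = c} ≡ #{x | f x = x ∧ ψ x = c} [MOD p] := by
    let g : Function.End {x // ψ x = c} := fun x => ⟨f x, by rw [hψ, x.2]⟩
    have hg : ∀ (k : ℕ) (x : {x // ψ x = c}), ((g ^ k) x : G) = f^[k] x := by
      intro k
      induction k with
      | zero => intro x; rfl
      | succ k ih => intro x; rw [pow_succ, Function.iterate_succ_apply]; exact ih (g x)
    have h := Equiv.Perm.card_fixedPoints_modEq (f := g) (p := p) (n := 1) (by
      funext x; ext; rw [pow_one, hg, hf]; rfl)
    rw [Fintype.card_subtype] at h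
    convert h using 1
    rw [← Set.toFinset_card]
    refine card_bij' (fun x hx => ⟨x, (mem_filter.1 hx).2.2⟩) (fun x _ => x) ?_ ?_ ?_ ?_
    · intro x hx
      rw [Set.mem_toFinset]
      ext; exact (mem_filter.1 hx).2.1
    · intro x hx
      rw [Set.mem_toFinset] at hx
      simpa using ⟨congrArg Subtype.val hx, x.2⟩
    · intros; rfl
    · intros; rfl
  have hmaps : ∀ s : Finset G, ∀ x ∈ s, ψ x ∈ univ.image ψ :=
    fun s x _ => mem_image_of_mem _ (mem_univ _)
  rw [← sum_fiberwise_of_maps_to (hmaps univ), ← sum_fiberwise_of_maps_to (hmaps _)]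
  refine Int.ModEq.sum fun c _ => ?_
  rw [sum_congr rfl fun x hx => (mem_filter.1 hx).2,
    sum_congr (g := fun _ => c) rfl fun x hx => (mem_filter.1 hx).2, sum_const, sum_const,
    filter_filter, nsmul_eq_mul, nsmul_eq_mul]
  exact ((Int.natCast_modEq_iff).2 (key c)).mul_right c
variable {K : Type*} [Field K]

theorem pow_two_pow_two_mul (r : ℕ) (x : K) : x ^ 2 ^ (2 * r) = (x ^ 2 ^ r) ^ 2 ^ r := by
  rw [two_mul, pow_add, pow_mul]

theorem cubeRoot_pow_two_pow {r : ℕ} {w : K} (hw : w ^ 2 + w + 1 = 0) (hr : Even r) : w ^ 2 ^ r = w := by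
  obtain ⟨k, rfl⟩ := hr
  rw [← two_mul]
  refine pow_two_pow_mul_of_fixed (s := 2) ?_ k
  linear_combination (w ^ 2 - w) * hw

theorem cubeRoot_pow_three {w : K} (hw : w ^ 2 + w + 1 = 0) : w ^ 3 = 1 := by
  linear_combination (w - 1) * hw

variable [CharP K 2] {r n : ℕ} {a : K}

theorem polarMap_eq_zero_iff (ha0 : a ≠ 0) (x : K) :
    polarMap r a x = 0 ↔ a * frobAddSelf K (2 * r) x ^ 4 = frobAddSelf K (2 * r) x := by
  rw [polarMap, CharTwo.add_eq_zero, sq, mul_assoc, frobAddSelf_apply]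
  exact mul_right_inj' ha0

theorem frobAddSelf_two_mul (x : K) :
    frobAddSelf K (2 * r) x = frobAddSelf K r (frobAddSelf K r x) := by
  simp only [frobAddSelf_apply, add_pow_char_pow, pow_two_pow_two_mul]
  linear_combination -(x ^ 2 ^ r) * CharTwo.two_eq_zero (R := K)

variable [Fintype K] [DecidableEq K]

/-- The map is x ↦ x^q + x applied twice. A preimage under the outer map can be shifted by its own
trace c in F_q: as n is odd, the new trace is c + nc = 0, so the shifted element is again in the
image. -/
theorem exists_frobAddSelf_two_mul_iff (hr : 0 < r) (hn : Odd n)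
    (hK : Fintype.card K = 2 ^ (r * n)) (t : K) :
    (∃ x, frobAddSelf K (2 * r) x = t) ↔ frobSum r n t = 0 := by
  have hz (x : K) : frobSum r n (frobAddSelf K r x) = 0 := by
    rw [frobAddSelf_apply, frobSum_telescope, ← hK, FiniteField.pow_card,
      CharTwo.add_self_eq_zero]
  constructor
  · rintro ⟨x, rfl⟩
    rw [frobAddSelf_two_mul, hz]
  · intro h
    obtain ⟨x, rfl⟩ := (exists_pow_add_self_eq_iff hr hn.pos hK t).2 h
    have hc : frobSum r n x ^ 2 ^ r = frobSum r n x := by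
      rw [← CharTwo.add_eq_zero, ← frobSum_pow, ← frobSum_add, h]
    obtain ⟨y, hy⟩ := (exists_pow_add_self_eq_iff hr hn.pos hK (x + frobSum r n x)).2 (by
      rw [frobSum_add, frobSum_of_fixed _ _ _ hc]
      obtain ⟨k, rfl⟩ := hn
      push_cast
      linear_combination (k + 1) * frobSum r (2 * k + 1) x * CharTwo.two_eq_zero (R := K))
    refine ⟨y, ?_⟩
    rw [frobAddSelf_two_mul, frobAddSelf_apply r y, hy, map_add, frobAddSelf_apply,
      frobAddSelf_apply, hc, CharTwo.add_self_eq_zero, add_zero]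

omit [DecidableEq K] in
theorem frobAddSelf_two_mul_eq_zero_iff (hn : Odd n) (hK : Fintype.card K = 2 ^ (r * n)) (x : K) :
    frobAddSelf K (2 * r) x = 0 ↔ x ^ 2 ^ r = x := by
  rw [frobAddSelf_apply, CharTwo.add_eq_zero]
  constructor
  · intro h
    obtain ⟨k, rfl⟩ := hn
    have h1 : x ^ 2 ^ (r * (2 * k + 1)) = x := by rw [← hK, FiniteField.pow_card]
    have h2 := pow_two_pow_mul_of_fixed h k
    rw [show r * (2 * k + 1) = 2 * r * k + r by ring, pow_add, pow_mul, h2] at h1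
    exact h1
  · intro h
    rw [pow_two_pow_two_mul, h, h]

theorem card_polarMap_eq_zero (hr : 0 < r) (hn : Odd n) (hK : Fintype.card K = 2 ^ (r * n))
    (ha0 : a ≠ 0) :
    #{x | polarMap r a x = 0} = 2 ^ r * #(traceZeroRoots r n a) := by
  have h := sum_comp_addMonoidHom (frobAddSelf K (2 * r)) (fun t => if a * t ^ 4 = t then 1 else 0)
  rw [← sum_filter, ← sum_filter, sum_const, sum_const, smul_eq_mul, smul_eq_mul, mul_one, mul_one,
    Nat.cast_id] at h
  simp only [polarMap_eq_zero_iff ha0, h, frobAddSelf_two_mul_eq_zero_iff hn hK,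
    card_pow_two_pow_eq_self hr hn.pos hK]
  congr 2
  ext t
  have := exists_frobAddSelf_two_mul_iff hr hn hK t
  simp only [traceZeroRoots, mem_filter, mem_image, mem_univ, true_and, this, and_comm]

theorem sq_sum_curveSign_odd (hr : 0 < r) (hn : Odd n) (hK : Fintype.card K = 2 ^ (r * n))
    (ha : a ^ 2 ^ r = a) (ha0 : a ≠ 0)
    (hrad : ∀ x, polarMap r a x = 0 → curveSign r (r * n) a x = 1) :
    (∑ x, curveSign r (r * n) a x) ^ 2 =
      (2 ^ (r * ((n + 1) / 2))) ^ 2 * (#(traceZeroRoots r n a) : ℤ) := by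
  rw [sq_sum_curveSign (Nat.mul_pos hr hn.pos) hK ha,
    sum_congr rfl fun x hx => hrad x (mem_filter.1 hx).2, sum_const, nsmul_eq_mul, mul_one,
    card_polarMap_eq_zero hr hn hK ha0]
  obtain ⟨k, rfl⟩ := hn
  rw [show (2 * k + 1 + 1) / 2 = k + 1 by omega]
  push_cast
  ring

section CubeRoots

variable {w : K}

omit [CharP K 2] [Fintype K] [DecidableEq K] in
theorem curveSign_cubeRoot_mul {N : ℕ} (hw : w ^ 2 + w + 1 = 0) (hr : Even r) (x : K) :
    curveSign r N a (w * x) = curveSign r N a x := by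
  rw [curveSign, curveFun_mul (cubeRoot_pow_two_pow hw hr), cubeRoot_pow_three hw, mul_one,
    curveSign]

omit [DecidableEq K] in
-- On the radical the sign is multiplicative, and x + wx = w^2 x; invariance under w gives ψ(x) =
-- ψ(x)^2 = 1.
theorem curveSign_eq_one_of_polarMap_eq_zero {N : ℕ} (hK : Fintype.card K = 2 ^ N)
    (ha : a ^ 2 ^ r = a) (hw : w ^ 2 + w + 1 = 0) (hr : Even r) (x : K)
    (hx : polarMap r a x = 0) : curveSign r N a x = 1 := by
  have h := curveSign_add hK ha x (w * x)
  rw [hx, mul_zero, (traceSign_eq_one_iff _ _).2 (frobSum_zero _ _), curveSign_cubeRoot_mul hw hr,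
    mul_one,
    show curveSign r N a x * curveSign r N a x = 1 from traceSign_mul_self _ _,
    show x + w * x = w * (w * x) by
      linear_combination x * hw - w ^ 2 * x * CharTwo.two_eq_zero (R := K),
    curveSign_cubeRoot_mul hw hr, curveSign_cubeRoot_mul hw hr] at h
  exact h

theorem sum_curveSign_modEq_one {N : ℕ} (hw : w ^ 2 + w + 1 = 0) (hr : Even r) :
    ∑ x, curveSign r N a x ≡ 1 [ZMOD 3] := by
  have h3 := cubeRoot_pow_three hw
  have hw1 : w ≠ 1 := by
    rintro rfl
    have : (1 : K) = 0 := by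
      linear_combination hw - CharTwo.two_eq_zero (R := K)
    exact one_ne_zero this
  have : Fact (Nat.Prime 3) := ⟨Nat.prime_three⟩
  have h := sum_modEq_sum_fixed (p := 3) (fun x => w * x) (by
    funext x
    simp only [Function.iterate_succ, Function.iterate_zero, Function.comp_apply, id]
    linear_combination x * h3) (curveSign r N a) (curveSign_cubeRoot_mul hw hr)
  have hfix : ({x | w * x = x} : Finset K) = {0} := by
    ext x
    simp only [mem_filter, mem_univ, true_and, mem_singleton]
    constructor
    · intro hx
      have : (w - 1) * x = 0 := by linear_combination hx
      exact (mul_eq_zero.1 this).resolve_left (sub_ne_zero.2 hw1)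
    · rintro rfl; simp
  rw [hfix, sum_singleton] at h
  refine h.trans ?_
  rw [curveSign, (traceSign_eq_one_iff _ _).2]
  rw [curveFun, zero_pow (by positivity), zero_pow (by positivity), add_zero, mul_zero, frobSum_zero]

end CubeRoots

theorem two_pow_modEq_one_of_even {k : ℕ} (hk : Even k) : (2 : ℤ) ^ k ≡ 1 [ZMOD 3] := by
  obtain ⟨j, rfl⟩ := hk
  rw [← two_mul, pow_mul]
  simpa using (show (2 : ℤ) ^ 2 ≡ 1 [ZMOD 3] by decide).pow j

/-- The sum over an extension of odd degree of a field that contains the cube roots of unity. -/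
theorem sum_curveSign_odd_of_even (hr : 0 < r) (hr2 : Even r) (hn : Odd n)
    (hK : Fintype.card K = 2 ^ (r * n)) (ha : a ^ 2 ^ r = a) (ha0 : a ≠ 0) {w : K}
    (hw : w ^ 2 + w + 1 = 0) :
    (#(traceZeroRoots r n a) = 1 → ∑ x, curveSign r (r * n) a x = 2 ^ (r * ((n + 1) / 2))) ∧
    (#(traceZeroRoots r n a) = 4 →
      ∑ x, curveSign r (r * n) a x = -2 ^ (r * ((n + 1) / 2) + 1)) := by
  have hsq := sq_sum_curveSign_odd hr hn hK ha ha0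
    (curveSign_eq_one_of_polarMap_eq_zero hK ha hw hr2)
  have hmod : ∑ x, curveSign r (r * n) a x ≡ 1 [ZMOD 3] := sum_curveSign_modEq_one hw hr2
  have hq := two_pow_modEq_one_of_even (hr2.mul_right ((n + 1) / 2))
  generalize ∑ x, curveSign r (r * n) a x = S at hsq hmod ⊢
  rw [pow_succ]
  generalize (2 : ℤ) ^ (r * ((n + 1) / 2)) = Q at hsq hq ⊢
  rw [Int.ModEq] at hmod hq
  -- Since Q ≡ 1 and S ≡ 1 mod 3, S = ±Q forces S = Q, while S = ±2Q forces S = -2Q.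
  constructor <;> intro h <;> rw [h] at hsq
  · rcases sq_eq_sq_iff_eq_or_eq_neg.1 (show S ^ 2 = Q ^ 2 by simpa using hsq) with h | h <;> omega
  · rcases sq_eq_sq_iff_eq_or_eq_neg.1 (show S ^ 2 = (Q * 2) ^ 2 by rw [hsq]; push_cast; ring)
      with h | h <;> omega

end OddDegree

/-! ### Counting the roots of aT^4 = T with vanishing trace -/

section RootCount

open Finset

variable {K : Type*} [Field K] [CharP K 2] [Fintype K] {r k : ℕ} {a w : K}

omit [Fintype K] in
theorem pow_four_eq_self_iff (hw : w ^ 2 + w + 1 = 0) (s : K) :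
    s ^ 4 = s ↔ s = 0 ∨ s = 1 ∨ s = w ∨ s = w + 1 := by
  have e : s ^ 4 - s = s * ((s - 1) * ((s - w) * (s - (w + 1)))) := by
    linear_combination (s - s ^ 2) * hw + (s ^ 3 * (w + 1) - s ^ 2 * w - s) *
      CharTwo.two_eq_zero (R := K)
  rw [← sub_eq_zero, e, mul_eq_zero, mul_eq_zero, mul_eq_zero, sub_eq_zero, sub_eq_zero,
    sub_eq_zero]

omit [Fintype K] in
theorem card_pow_four_roots [DecidableEq K] (hw : w ^ 2 + w + 1 = 0) :
    #({0, 1, w, w + 1} : Finset K) = 4 := by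
  have h2 := CharTwo.two_eq_zero (R := K)
  have h0 : w ≠ 0 := by rintro rfl; simp at hw
  have h1 : w ≠ 1 := by
    rintro rfl
    exact one_ne_zero (show (1 : K) = 0 by linear_combination hw - h2)
  have h3 : w + 1 ≠ 0 := fun h => h1 (CharTwo.add_eq_zero.1 h)
  rw [card_insert_of_notMem, card_insert_of_notMem, card_insert_of_notMem, card_singleton]
  · simp
  · simp [h1.symm, h0]
  · simp [h0.symm, h3.symm]

theorem exists_cubeRoot {N : ℕ} (hN : 0 < N) (hN2 : Even N) (hK : Fintype.card K = 2 ^ N) :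
    ∃ w : K, w ^ 2 + w + 1 = 0 := by
  classical
  obtain ⟨w, hw⟩ := (exists_pow_add_self_eq_iff Nat.one_pos hN (by rwa [one_mul]) (1 : K)).2 (by
    rw [frobSum_of_fixed _ _ _ (one_pow _), mul_one]
    obtain ⟨j, rfl⟩ := hN2
    push_cast
    exact CharTwo.add_self_eq_zero _)
  exact ⟨w, by rw [← CharTwo.add_self_eq_zero (1 : K)]; linear_combination hw⟩

omit [Fintype K] in
theorem natCast_eq_zero_of_even {j : ℕ} (hj : Even j) : (j : K) = 0 :=
  (CharP.cast_eq_zero_iff K 2 j).2 hj.two_dvd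

omit [Fintype K] in
theorem natCast_eq_one_of_odd {j : ℕ} (hj : Odd j) : (j : K) = 1 := by
  obtain ⟨i, rfl⟩ := hj
  push_cast
  linear_combination (i : K) * CharTwo.two_eq_zero (R := K)

variable [DecidableEq K]

omit [CharP K 2] in
theorem mem_traceZeroRoots {T : K} :
    T ∈ traceZeroRoots r k a ↔ a * T ^ 4 = T ∧ frobSum r k T = 0 := by
  simp [traceZeroRoots]

omit [CharP K 2] in
theorem card_traceZeroRoots_of_cube {c : K} (hc : c ^ 2 ^ r = c) (h : a * c ^ 3 = 1) :
    #(traceZeroRoots r k a) = #(traceZeroRoots r k (1 : K)) := by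
  have hc0 : c ≠ 0 := by rintro rfl; simp at h
  symm
  refine card_bij (fun s _ => c * s) ?_ ?_ ?_
  · intro s hs
    rw [mem_traceZeroRoots] at hs ⊢
    rw [frobSum_mul_of_fixed _ _ _ _ hc, hs.2, mul_zero]
    exact ⟨by linear_combination c * s ^ 4 * h + c * hs.1, rfl⟩
  · intro s _ t _ hst
    exact mul_left_cancel₀ hc0 hst
  · intro t ht
    rw [mem_traceZeroRoots] at ht
    have e : c * (c⁻¹ * t) = t := mul_inv_cancel_left₀ hc0 t
    refine ⟨c⁻¹ * t, ?_, e⟩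
    rw [mem_traceZeroRoots]
    rw [← e, frobSum_mul_of_fixed _ _ _ _ hc] at ht
    generalize c⁻¹ * t = s at ht
    refine ⟨mul_left_cancel₀ hc0 ?_, (mul_eq_zero.1 ht.2).resolve_left hc0⟩
    linear_combination ht.1 - c * s ^ 4 * h

/-- A root lies in F_4 and in the field with 2^(rk) elements; as rk is odd it lies in F_2, and 1 has
trace k = 1. -/
theorem card_traceZeroRoots_one_of_odd_odd (hr : Odd r) (hk : Odd k) :
    #(traceZeroRoots r k (1 : K)) = 1 := by
  rw [card_eq_one]
  refine ⟨0, ?_⟩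
  ext T
  rw [mem_traceZeroRoots, mem_singleton, one_mul]
  constructor
  · rintro ⟨h4, hT⟩
    have h := pow_eq_self_of_frobSum_eq_zero hT
    obtain ⟨j, hj⟩ := hr.mul hk
    rw [hj, pow_add, pow_mul, pow_two_pow_mul_of_fixed (s := 2) h4, pow_one] at h
    have h1 : T * (T - 1) = 0 := by linear_combination h
    rcases mul_eq_zero.1 h1 with h0 | h0
    · exact h0
    · rw [sub_eq_zero.1 h0, frobSum_of_fixed _ _ _ (one_pow _), natCast_eq_one_of_odd hk] at hT
      simp at hT
  · rintro rfl
    simp [frobSum_zero]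

theorem traceZeroRoots_one (hw : w ^ 2 + w + 1 = 0) :
    traceZeroRoots r k (1 : K) = {T ∈ ({0, 1, w, w + 1} : Finset K) | frobSum r k T = 0} := by
  ext T
  rw [mem_traceZeroRoots, mem_filter, one_mul, pow_four_eq_self_iff hw]
  simp

theorem card_traceZeroRoots_one_of_even (hw : w ^ 2 + w + 1 = 0) (hr : Even r) :
    (Odd k → #(traceZeroRoots r k (1 : K)) = 1) ∧
      (Even k → #(traceZeroRoots r k (1 : K)) = 4) := by
  have hf (T : K) (h4 : T ^ 4 = T) : frobSum r k T = k * T := by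
    apply frobSum_of_fixed
    obtain ⟨j, rfl⟩ := hr
    rw [← two_mul]
    exact pow_two_pow_mul_of_fixed (s := 2) h4 j
  constructor <;> intro hk
  · rw [card_eq_one]
    refine ⟨0, ?_⟩
    ext T
    rw [mem_traceZeroRoots, mem_singleton, one_mul]
    constructor
    · rintro ⟨h4, h⟩
      rwa [hf T h4, natCast_eq_one_of_odd hk, one_mul] at h
    · rintro rfl
      simp [frobSum_zero]
  · rw [traceZeroRoots_one hw, filter_true_of_mem, card_pow_four_roots hw]
    intro T hT
    rw [hf T ((pow_four_eq_self_iff hw T).2 (by simpa using hT)), natCast_eq_zero_of_even hk,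
      zero_mul]

/-- For odd r the q-power Frobenius swaps w and w + 1, so consecutive iterates of w pair up to 1 and
w has trace k/2. -/
theorem card_traceZeroRoots_one_of_odd (hw : w ^ 2 + w + 1 = 0) (hr : Odd r) :
    (k % 4 = 2 → #(traceZeroRoots r k (1 : K)) = 2) ∧
      (k % 4 = 0 → #(traceZeroRoots r k (1 : K)) = 4) := by
  have hwq : w ^ 2 ^ r = w + 1 := by
    obtain ⟨j, rfl⟩ := hr
    rw [pow_succ, pow_mul, cubeRoot_pow_two_pow hw (even_two_mul j)]
    linear_combination hw - (w + 1) * CharTwo.two_eq_zero (R := K)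
  have hfw (j : ℕ) : frobSum r (2 * j) w = j := by
    induction j with
    | zero => simp [frobSum]
    | succ j ih =>
      have hw2 : w ^ 2 ^ (r * (2 * j)) = w :=
        cubeRoot_pow_two_pow hw ((even_two_mul j).mul_left r)
      rw [frobSum, mul_add, mul_one, sum_range_succ, sum_range_succ, ← frobSum, ih, hw2, mul_add r,
        mul_one, pow_add 2, pow_mul w, hw2, hwq]
      push_cast
      linear_combination w * CharTwo.two_eq_zero (R := K)
  have hone : frobSum r k (1 : K) = k := by rw [frobSum_of_fixed _ _ _ (one_pow _), mul_one]
  constructor <;> intro hk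
  · obtain ⟨j, rfl⟩ : ∃ j, k = 2 * j := ⟨k / 2, by omega⟩
    have hj : ((j : ℕ) : K) = 1 := natCast_eq_one_of_odd (Nat.odd_iff.2 (by omega))
    rw [natCast_eq_zero_of_even (even_two_mul j)] at hone
    rw [traceZeroRoots_one hw, filter_insert, filter_insert, filter_insert, filter_singleton,
      frobSum_add, hfw, hone, hj, frobSum_zero]
    simp
  · obtain ⟨j, rfl⟩ : ∃ j, k = 2 * j := ⟨k / 2, by omega⟩
    have hj : ((j : ℕ) : K) = 0 := natCast_eq_zero_of_even (Nat.even_iff.2 (by omega))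
    rw [natCast_eq_zero_of_even (even_two_mul j)] at hone
    rw [traceZeroRoots_one hw, filter_true_of_mem, card_pow_four_roots hw]
    intro T hT
    simp only [mem_insert, mem_singleton] at hT
    rcases hT with rfl | rfl | rfl | rfl
    · exact frobSum_zero _ _
    · exact hone
    · rw [hfw, hj]
    · rw [frobSum_add, hfw, hone, hj, add_zero]

omit [CharP K 2] [Fintype K] [DecidableEq K] in
/-- A cube root of `a⁻¹` that is not fixed by Frobenius is multiplied by a primitive cube root of
unity. -/
theorem exists_pow_eq_mul_of_not_cube (ha : a ^ 2 ^ r = a)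
    (hcube : ¬∃ c : K, c ^ 2 ^ r = c ∧ a * c ^ 3 = 1) {T : K} (hT : a * T ^ 3 = 1) :
    ∃ z : K, z ^ 2 + z + 1 = 0 ∧ T ^ 2 ^ r = z * T := by
  have hT0 : T ≠ 0 := by rintro rfl; simp at hT
  have hTq : a * (T ^ 2 ^ r) ^ 3 = 1 := by
    have := congrArg (· ^ 2 ^ r) hT
    simpa only [mul_pow, ha, pow_right_comm _ 3, one_pow] using this
  have ha0 : a ≠ 0 := by rintro rfl; simp at hT
  refine ⟨T ^ 2 ^ r / T, ?_, (div_mul_cancel₀ _ hT0).symm⟩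
  have h3 : (T ^ 2 ^ r / T) ^ 3 = 1 := by
    rw [div_pow, div_eq_one_iff_eq (pow_ne_zero 3 hT0)]
    exact mul_left_cancel₀ ha0 (hTq.trans hT.symm)
  have h1 : T ^ 2 ^ r / T ≠ 1 := by
    intro h
    rw [div_eq_one_iff_eq hT0] at h
    exact hcube ⟨T, h, hT⟩
  generalize T ^ 2 ^ r / T = z at h3 h1
  have : (z - 1) * (z ^ 2 + z + 1) = 0 := by linear_combination h3
  exact (mul_eq_zero.1 this).resolve_left (sub_ne_zero.2 h1)

omit [CharP K 2] [Fintype K] [DecidableEq K] in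
theorem pow_two_pow_mul_of_pow_eq_mul {T z : K} (hz : z ^ 2 ^ r = z) (hT : T ^ 2 ^ r = z * T)
    (i : ℕ) : T ^ 2 ^ (r * i) = z ^ i * T := by
  induction i with
  | zero => simp
  | succ i ih =>
    rw [mul_add, mul_one, pow_add, pow_mul, ih, mul_pow, hT, pow_right_comm, hz]
    ring

/-- A nonzero root has T^q = zT with z a primitive cube root of unity, so its iterates are z^i T.
Vanishing trace forces z^k = 1, that is 3 ∣ k, and then the geometric sum does vanish. -/
theorem card_traceZeroRoots_of_not_cube (hr : Even r) (ha : a ^ 2 ^ r = a) (ha0 : a ≠ 0)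
    (hcube : ¬∃ c : K, c ^ 2 ^ r = c ∧ a * c ^ 3 = 1) :
    (¬3 ∣ k → #(traceZeroRoots r k a) = 1) ∧
      (3 ∣ k → (∃ T : K, a * T ^ 3 = 1) → #(traceZeroRoots r k a) = 4) := by
  constructor
  · intro hk
    rw [card_eq_one]
    refine ⟨0, ?_⟩
    ext T
    rw [mem_traceZeroRoots, mem_singleton]
    constructor
    · rintro ⟨h4, h⟩
      by_contra hT0
      have hT : a * T ^ 3 = 1 := mul_right_cancel₀ hT0 (by linear_combination h4)
      obtain ⟨z, hz, hTz⟩ := exists_pow_eq_mul_of_not_cube ha hcube hT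
      have h1 := pow_eq_self_of_frobSum_eq_zero h
      rw [pow_two_pow_mul_of_pow_eq_mul (cubeRoot_pow_two_pow hz hr) hTz] at h1
      have h2 : z ^ k = 1 := mul_right_cancel₀ hT0 (by rw [h1, one_mul])
      have hz1 : z ≠ 1 := by
        rintro rfl
        exact hcube ⟨T, by rw [hTz, one_mul], hT⟩
      exact hk ((orderOf_eq_prime (cubeRoot_pow_three hz) hz1 : orderOf z = 3) ▸
        orderOf_dvd_of_pow_eq_one h2)
    · rintro rfl
      simp [frobSum_zero]
  · rintro ⟨j, rfl⟩ ⟨T, hT⟩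
    have hT0 : T ≠ 0 := by rintro rfl; simp at hT
    obtain ⟨z, hz, hTz⟩ := exists_pow_eq_mul_of_not_cube ha hcube hT
    have hzr := cubeRoot_pow_two_pow hz hr
    have hfT : frobSum r (3 * j) T = 0 := by
      simp only [frobSum, pow_two_pow_mul_of_pow_eq_mul hzr hTz, ← sum_mul]
      have h := geom_sum_mul z (3 * j)
      rw [pow_mul, cubeRoot_pow_three hz, one_pow, sub_self] at h
      have hz1 : z ≠ 1 := by
        rintro rfl
        exact hcube ⟨T, by rw [hTz, one_mul], hT⟩
      rw [(mul_eq_zero.1 h).resolve_right (sub_ne_zero.2 hz1), zero_mul]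
    have hset : traceZeroRoots r (3 * j) a =
        ({0, 1, z, z + 1} : Finset K).image (fun s => s * T) := by
      ext x
      have hx : x = x / T * T := (div_mul_cancel₀ x hT0).symm
      rw [mem_traceZeroRoots, mem_image]
      constructor
      · rintro ⟨h4, -⟩
        refine ⟨x / T, ?_, hx.symm⟩
        have := (pow_four_eq_self_iff hz (x / T)).1 (by
          rw [div_pow, div_eq_div_iff (pow_ne_zero 4 hT0) hT0]
          apply mul_left_cancel₀ ha0
          linear_combination T * h4 - x * T * hT)
        simpa using this
      · rintro ⟨s, hs, rfl⟩
        have hs4 := (pow_four_eq_self_iff hz s).2 (by simpa using hs)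
        refine ⟨by linear_combination a * T ^ 4 * hs4 + s * T * hT, ?_⟩
        rw [frobSum_mul_of_fixed, hfT, mul_zero]
        obtain ⟨i, rfl⟩ := hr
        rw [← two_mul]
        exact pow_two_pow_mul_of_fixed (s := 2) hs4 i
    rw [hset, card_image_of_injective _ (mul_left_injective₀ hT0), card_pow_four_roots hz]

omit [DecidableEq K] [CharP K 2] in
-- The cyclic group of units has order (q - 1)(1 + q + ... + q^(n-1)), and the second factor is ≡ n
-- ≡ 0 mod 3 because q ≡ 1. Elements of order dividing q - 1 are therefore cubes.
theorem exists_mul_cube_eq_one (hr : Even r) {n : ℕ} (hn : 3 ∣ n)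
    (hK : Fintype.card K = 2 ^ (r * n)) (ha : a ^ 2 ^ r = a) (ha0 : a ≠ 0) :
    ∃ T : K, a * T ^ 3 = 1 := by
  have hq3 : 2 ^ r ≡ 1 [MOD 3] := by
    obtain ⟨j, rfl⟩ := hr
    rw [← two_mul, pow_mul]
    simpa using (show 2 ^ 2 ≡ 1 [MOD 3] by decide).pow j
  have hq1 : 1 ≤ 2 ^ r := Nat.one_le_two_pow
  obtain ⟨s, hs⟩ : 3 ∣ ∑ i ∈ range n, (2 ^ r) ^ i := by
    rw [← Nat.modEq_zero_iff_dvd]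
    calc ∑ i ∈ range n, (2 ^ r) ^ i ≡ ∑ i ∈ range n, 1 ^ i [MOD 3] :=
          Nat.ModEq.sum fun i _ => hq3.pow i
      _ = n := by simp
      _ ≡ 0 [MOD 3] := (Nat.modEq_zero_iff_dvd).2 hn
  have hcard : Nat.card Kˣ = 3 * ((2 ^ r - 1) * s) := by
    rw [Nat.card_units, Nat.card_eq_fintype_card, hK, pow_mul, ← geom_sum_mul_of_one_le hq1 n, hs]
    ring
  obtain ⟨g, hg⟩ := IsCyclic.exists_monoid_generator (α := Kˣ)
  obtain ⟨j, hj⟩ := hg (Units.mk0 a ha0)⁻¹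
  have ha1 : (Units.mk0 a ha0) ^ (2 ^ r - 1) = 1 := by
    ext
    rw [Units.val_pow_eq_pow_val, Units.val_mk0, Units.val_one]
    refine mul_right_cancel₀ ha0 ?_
    rw [← pow_succ, Nat.sub_add_cancel hq1, ha, one_mul]
  have h1 : g ^ (j * ((2 ^ r - 1) * s)) = 1 := by
    rw [pow_mul, show g ^ j = _ from hj, pow_mul, inv_pow, ha1, inv_one, one_pow]
  have hord : orderOf g = Nat.card Kˣ :=
    orderOf_eq_card_of_forall_mem_zpowers fun x => by
      obtain ⟨i, hi⟩ := hg x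
      exact ⟨i, by simpa using hi⟩
  have h2 := orderOf_dvd_of_pow_eq_one h1
  have hpos : 0 < (2 ^ r - 1) * s := by
    have : 0 < Nat.card Kˣ := Nat.card_pos
    rw [hcard] at this
    exact Nat.pos_of_mul_pos_left this
  rw [hord, hcard] at h2
  obtain ⟨i, rfl⟩ := Nat.dvd_of_mul_dvd_mul_right hpos h2
  refine ⟨(g ^ i : Kˣ), ?_⟩
  have h3 : (Units.mk0 a ha0) * (g ^ i) ^ 3 = 1 := by
    rw [← pow_mul, mul_comm i, show g ^ (3 * i) = _ from hj, mul_inv_cancel]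
  simpa using congrArg Units.val h3

end RootCount

/-! ### The sign when r and n are both odd -/

section OddOverOdd

open Finset

theorem chi_eight_of_odd {n : ℕ} (hn : Odd n) :
    ZMod.χ₈ (n : ZMod 8) = 1 ∨ ZMod.χ₈ (n : ZMod 8) = -1 := by
  rw [ZMod.χ₈_nat_eq_if_mod_eight, if_neg (by rw [Nat.odd_iff] at hn; omega)]
  split_ifs <;> simp

/-- The sum over an extension of odd degree of `𝔽_{2 ^ r}`, `r` odd: its absolute value is known
and its sign is compared with that over subextensions of prime index. -/
theorem sum_curveSign_odd_of_odd {r : ℕ} (hr : Odd r) (n : ℕ) (hn : Odd n) :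
    ∀ (K : Type*) [Field K] [CharP K 2] [Fintype K], Fintype.card K = 2 ^ (r * n) →
      ∑ x : K, curveSign r (r * n) 1 x = ZMod.χ₈ n * 2 ^ (r * ((n + 1) / 2)) := by
  induction n using Nat.strong_induction_on with
  | _ n ih =>
  intro K _ _ _ hK
  classical
  have hfixed (x : K) (hx : x ^ 2 ^ r = x) : curveSign r (r * n) 1 x = 1 := by
    rw [curveSign, traceSign_eq_one_iff, curveFun, pow_succ, pow_two_pow_succ, pow_add, hx,
      show 1 * (x ^ 2 * x + x * x ^ 2) = 0 by
        linear_combination x ^ 3 * CharTwo.two_eq_zero (R := K), frobSum_zero]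
  by_cases hn1 : n = 1
  · subst hn1
    rw [sum_congr rfl fun x _ => hfixed x (by rw [mul_one] at hK; rw [← hK, FiniteField.pow_card])]
    simp [hK]
  have hroots : #(traceZeroRoots r n (1 : K)) = 1 := card_traceZeroRoots_one_of_odd_odd hr hn
  -- The only admissible root is 0, so the radical is F_q, where the two monomials cancel.
  have hsq := sq_sum_curveSign_odd hr.pos hn hK (one_pow _) one_ne_zero (fun x hx => by
    refine hfixed x ((frobAddSelf_two_mul_eq_zero_iff hn hK x).1 ?_)
    rw [polarMap_eq_zero_iff one_ne_zero] at hx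
    obtain ⟨t, ht⟩ := card_eq_one.1 hroots
    have h0 : (0 : K) ∈ traceZeroRoots r n (1 : K) := by simp [mem_traceZeroRoots, frobSum_zero]
    have h1 : frobAddSelf K (2 * r) x ∈ traceZeroRoots r n (1 : K) :=
      mem_traceZeroRoots.2 ⟨hx, (exists_frobAddSelf_two_mul_iff hr.pos hn hK _).1 ⟨x, rfl⟩⟩
    rw [ht, mem_singleton] at h0 h1
    rw [h1, h0])
  rw [hroots, Nat.cast_one, mul_one] at hsq
  obtain ⟨p, hp, m, rfl⟩ : ∃ p, p.Prime ∧ p ∣ n := Nat.exists_prime_and_dvd hn1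
  have hpo : Odd p := Nat.Odd.of_mul_left hn
  have hmo : Odd m := Nat.Odd.of_mul_right hn
  have : Fact p.Prime := ⟨hp⟩
  have hp2 : p ≠ 2 := by rintro rfl; exact absurd hpo (by decide)
  let L : Subfield K := (iterateFrobenius K 2 (r * m)).eqLocusField (RingHom.id K)
  have hmem (x : K) : x ∈ L ↔ x ^ 2 ^ (r * m) = x := by
    rw [RingHom.mem_eqLocusField, iterateFrobenius_def]; rfl
  have hK' : Fintype.card K = 2 ^ (r * m * p) := by rw [hK]; ring_nf
  have hL : Fintype.card L = 2 ^ (r * m) := by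
    rw [← card_pow_two_pow_eq_self (Nat.mul_pos hr.pos hmo.pos) hp.pos hK', Fintype.card_subtype]
    simp only [hmem]
  have hchar : CharP L 2 := inferInstance
  have hIH := ih m (by
    have := hp.two_le
    have := hmo.pos
    nlinarith) hmo L hL
  have hmod := sum_modEq_sum_fixed (p := p) (fun x : K => x ^ 2 ^ (r * m)) (by
    have h (j : ℕ) (x : K) : (fun x : K => x ^ 2 ^ (r * m))^[j] x = x ^ 2 ^ (r * m * j) := by
      induction j generalizing x with
      | zero => simp
      | succ j ihj =>
        rw [Function.iterate_succ_apply, ihj, ← pow_mul, ← pow_add]; ring_nf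
    funext x
    rw [h, ← hK', FiniteField.pow_card, id]) (curveSign r (r * (p * m)) 1) (fun x => by
    rw [curveSign, ← curveFun_pow (one_pow _), traceSign_pow, curveSign])
  have hsub : ∑ x : K with x ^ 2 ^ (r * m) = x, curveSign r (r * (p * m)) 1 x =
      ∑ x : L, curveSign r (r * m) 1 x := by
    have hval (x : L) : curveSign r (r * (p * m)) 1 (x : K) = curveSign r (r * m) 1 x := by
      have hx : (curveFun r 1 (x : K)) ^ 2 ^ (r * m) = curveFun r 1 (x : K) := by
        rw [curveFun_pow (one_pow _), (hmem x).1 x.2]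
      have hcoe : frobSum 1 (r * m) (curveFun r 1 (x : K)) =
          ((frobSum 1 (r * m) (curveFun r 1 x) : L) : K) := by
        simp [frobSum, curveFun]
      -- The trace from `K` of an element of `L` is p times its trace from `L`, and p is odd.
      rw [curveSign, curveSign, traceSign, traceSign, show r * (p * m) = r * m * p by ring,
        frobSum_one_mul_of_fixed _ _ _ hx, natCast_eq_one_of_odd hpo, one_mul, hcoe]
      simp
    rw [← sum_congr rfl fun x _ => hval x]
    refine (sum_subtype _ (fun x => ?_) _)
    rw [mem_filter, hmem]; simp
  rw [hsub, hIH] at hmod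
  have hleg : (2 : ℤ) ^ (p / 2) ≡ ZMod.χ₈ p [ZMOD p] := by
    rw [← ZMod.intCast_eq_intCast_iff, ← legendreSym.at_two hp2, legendreSym.eq_pow]
    push_cast; rfl
  have hexp : r * ((p * m + 1) / 2) = r * ((m + 1) / 2) + p / 2 * (r * m) := by
    obtain ⟨i, rfl⟩ := hpo
    obtain ⟨j, rfl⟩ := hmo
    rw [show ((2 * i + 1) * (2 * j + 1) + 1) / 2 = i * (2 * j + 1) + (j + 1) by
        rw [show (2 * i + 1) * (2 * j + 1) + 1 = 2 * (i * (2 * j + 1) + (j + 1)) by ring]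
        omega,
      show (2 * i + 1) / 2 = i by omega, show (2 * j + 1 + 1) / 2 = j + 1 by omega]
    ring
  have he := chi_eight_of_odd hpo
  have hf := chi_eight_of_odd hmo
  have hQ : (2 : ℤ) ^ (r * ((p * m + 1) / 2)) ≡ 2 ^ (r * ((m + 1) / 2)) * ZMod.χ₈ p [ZMOD p] := by
    rw [hexp, pow_add, pow_mul 2 (p / 2)]
    refine Int.ModEq.mul_left _ ((hleg.pow _).trans ?_)
    -- The exponent r * m is odd, so the sign χ₈(p) survives the power.
    rcases he with he | he <;> rw [he]
    · rw [one_pow]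
    · rw [(hr.mul hmo).neg_one_pow]
  have hcop : IsCoprime (p : ℤ) (2 ^ (r * ((m + 1) / 2))) := by
    refine IsCoprime.pow_right ?_
    exact_mod_cast Nat.isCoprime_iff_coprime.2 (Nat.coprime_two_right.2 hpo)
  have hp3 : (3 : ℤ) ≤ p := by
    have := hp.two_le
    omega
  have hmul : ZMod.χ₈ ((p * m : ℕ) : ZMod 8) = ZMod.χ₈ p * ZMod.χ₈ m := by
    rw [Nat.cast_mul, map_mul]
  rw [hmul]
  have hdvd := Int.modEq_iff_dvd.1 hmod
  have hdvd' := Int.modEq_iff_dvd.1 hQ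
  generalize ∑ x : K, curveSign r (r * (p * m)) 1 x = S at hsq hdvd ⊢
  generalize (2 : ℤ) ^ (r * ((p * m + 1) / 2)) = Q at hsq hdvd' ⊢
  generalize (2 : ℤ) ^ (r * ((m + 1) / 2)) = R at hdvd hdvd' hcop
  generalize ZMod.χ₈ (p : ZMod 8) = e at he hdvd' ⊢
  generalize ZMod.χ₈ (m : ZMod 8) = f at hf hdvd ⊢
  -- For either sign of S, p divides f - e or f + e, which is at most 2 in absolute value while p ≥
  -- 3; hence it is 0.
  rcases sq_eq_sq_iff_eq_or_eq_neg.1 hsq with rfl | rfl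
  · have h1 : (p : ℤ) ∣ f - e := hcop.dvd_of_dvd_mul_left (by
      convert dvd_sub hdvd hdvd' using 1; ring)
    have h2 : f - e = 0 := Int.eq_zero_of_abs_lt_dvd h1 (by
      rcases he with rfl | rfl <;> rcases hf with rfl | rfl <;> norm_num <;> omega)
    rcases he with rfl | rfl <;> rcases hf with rfl | rfl <;> simp at h2 ⊢
  · have h1 : (p : ℤ) ∣ f + e := hcop.dvd_of_dvd_mul_left (by
      convert dvd_add hdvd hdvd' using 1; ring)
    have h2 : f + e = 0 := Int.eq_zero_of_abs_lt_dvd h1 (by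
      rcases he with rfl | rfl <;> rcases hf with rfl | rfl <;> norm_num <;> omega)
    rcases he with rfl | rfl <;> rcases hf with rfl | rfl <;> simp at h2 ⊢

end OddOverOdd

/-! ### From projective points to the exponential sum -/

section Points

open Finset

variable {F K : Type*} [Field F] [Field K] [Algebra F K]

theorem aeval_curveForm (r : ℕ) (α : F) (v : Fin 3 → K) :
    MvPolynomial.aeval v (curveForm r α) =
      v 1 ^ 2 * v 2 ^ (2 ^ (r + 1) - 1) + v 1 * v 2 ^ 2 ^ (r + 1) -
        algebraMap F K α * (v 0 ^ (2 ^ (r + 1) + 1) + v 0 ^ (2 ^ r + 2) * v 2 ^ (2 ^ r - 1)) := by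
  simp [curveForm]

/-- The affine points of the curve and its point at infinity. -/
def curvePointOfOption (r : ℕ) (α : F) :
    Option {p : K × K // p.2 ^ 2 + p.2 = curveFun r (algebraMap F K α) p.1} → curvePoints r α K
  | none => ⟨Projectivization.mk K ![0, 1, 0] (fun h => by simpa using congrFun h 1), by
      have h : 2 ^ (r + 1) - 1 ≠ 0 := by
        have := Nat.one_lt_two_pow (Nat.succ_ne_zero r); omega
      rw [mk_mem_curvePoints, aeval_curveForm]
      simp [h]⟩
  | some p => ⟨Projectivization.mk K ![p.1.1, p.1.2, 1] (fun h => by simpa using congrFun h 2), by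
      rw [mk_mem_curvePoints, aeval_curveForm]
      simp [p.2, curveFun]⟩

theorem curvePointOfOption_bijective {r : ℕ} (hr : 0 < r) {α : F} (hα : α ≠ 0) :
    Function.Bijective (curvePointOfOption (K := K) r α) := by
  have h2 : 2 ^ (r + 1) - 1 ≠ 0 := by
    have := Nat.one_lt_two_pow (Nat.succ_ne_zero r); omega
  constructor
  · rintro (_ | ⟨⟨x, y⟩, hp⟩) (_ | ⟨⟨x', y'⟩, hp'⟩) h
    · rfl
    · obtain ⟨c, hc⟩ := (Projectivization.mk_eq_mk_iff' ..).1 (congrArg Subtype.val h)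
      have h0 := congrFun hc 2
      have h1 := congrFun hc 1
      simp only [Pi.smul_apply, smul_eq_mul, Matrix.cons_val] at h0 h1
      simp_all
    · obtain ⟨c, hc⟩ := (Projectivization.mk_eq_mk_iff' ..).1 (congrArg Subtype.val h)
      have h0 := congrFun hc 2
      simp at h0
    · obtain ⟨c, hc⟩ := (Projectivization.mk_eq_mk_iff' ..).1 (congrArg Subtype.val h)
      have h0 := congrFun hc 2
      have h1 := congrFun hc 1
      have h3 := congrFun hc 0
      simp only [Pi.smul_apply, smul_eq_mul, Matrix.cons_val, mul_one] at h0 h1 h3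
      subst h0
      simp only [one_mul] at h1 h3
      subst h1 h3
      rfl
  · rintro ⟨P, hP⟩
    induction P using Projectivization.ind with
    | h v hv =>
    have hP' := (mk_mem_curvePoints ..).1 hP
    rw [aeval_curveForm] at hP'
    by_cases hz : v 2 = 0
    · have hx : v 0 = 0 := by
        by_contra hx
        have hα' : algebraMap F K α ≠ 0 := (map_ne_zero _).2 hα
        rw [hz, zero_pow h2, zero_pow (by positivity)] at hP'
        -- Positivity of r matters here: only then does the term x^(q+2) z^(q-1) vanish at z = 0.
        have h3 : 2 ^ r - 1 ≠ 0 := by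
          have := Nat.one_lt_two_pow hr.ne'; omega
        rw [zero_pow h3] at hP'
        simp [hα', hx] at hP'
      refine ⟨none, Subtype.ext ((Projectivization.mk_eq_mk_iff' ..).2 ⟨(v 1)⁻¹, ?_⟩)⟩
      have hy : v 1 ≠ 0 := by
        intro hy
        apply hv
        ext i; fin_cases i <;> simp [hx, hy, hz]
      ext i; fin_cases i <;> simp [hx, hy, hz]
    · refine ⟨some ⟨(v 0 / v 2, v 1 / v 2), ?_⟩,
        Subtype.ext ((Projectivization.mk_eq_mk_iff' ..).2 ⟨(v 2)⁻¹, ?_⟩)⟩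
      · have h := (mk_mem_curvePoints r α K ((v 2)⁻¹ • v) (by simp [hz, hv])).1 (by
          rwa [(Projectivization.mk_eq_mk_iff' K _ v _ hv).2 ⟨(v 2)⁻¹, rfl⟩])
        rw [aeval_curveForm] at h
        simp only [Pi.smul_apply, smul_eq_mul, inv_mul_cancel₀ hz, one_pow, mul_one] at h
        rw [curveFun, div_eq_inv_mul, div_eq_inv_mul]
        exact sub_eq_zero.1 h
      · ext i; fin_cases i <;> simp [hz, div_eq_inv_mul]

theorem card_curvePoints [CharP K 2] [Fintype K] {r N : ℕ} (hr : 0 < r) (hN : 0 < N)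
    (hK : Fintype.card K = 2 ^ N) {α : F} (hα : α ≠ 0) :
    (Nat.card (curvePoints r α K) : ℤ) =
      2 ^ N + 1 + ∑ x, curveSign r N (algebraMap F K α) x := by
  classical
  rw [← Nat.card_congr (Equiv.ofBijective _ (curvePointOfOption_bijective (K := K) hr hα)),
    Finite.card_option,
    Nat.card_congr (Equiv.subtypeProdEquivSigmaSubtype
      fun x y : K => y ^ 2 + y = curveFun r (algebraMap F K α) x),
    Nat.card_eq_fintype_card, Fintype.card_sigma]
  simp only [Fintype.card_subtype]
  push_cast
  rw [sum_congr rfl fun x _ => card_sq_add_self_eq hN hK _, sum_add_distrib]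
  simp only [sum_const, card_univ, hK, nsmul_eq_mul, mul_one]
  push_cast
  rw [add_right_comm]
  rfl

end Points

/-! ### Descent to the base field and scaling by cubes -/

section Values

open Finset

theorem exists_algebraMap_eq_of_fixed {F K : Type*} [Field F] [Field K] [Algebra F K] [Fintype K]
    [CharP K 2] {r n : ℕ} (hr : 0 < r) (hn : 0 < n) (hF : Nat.card F = 2 ^ r)
    (hK : Fintype.card K = 2 ^ (r * n)) (c : K) (hc : c ^ 2 ^ r = c) :
    ∃ x : F, algebraMap F K x = c := by
  classical
  have : Finite F := Nat.finite_of_card_ne_zero (by rw [hF]; positivity)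
  have := Fintype.ofFinite F
  rw [Nat.card_eq_fintype_card] at hF
  have h : univ.image (algebraMap F K) = ({c | c ^ 2 ^ r = c} : Finset K) := by
    refine eq_of_subset_of_card_le ?_ ?_
    · intro y hy
      obtain ⟨x, -, rfl⟩ := mem_image.1 hy
      rw [mem_filter, ← map_pow, ← hF, FiniteField.pow_card]
      simp
    · rw [card_pow_two_pow_eq_self hr hn hK,
        card_image_of_injective _ (algebraMap F K).injective, card_univ, hF]
  have hmem : c ∈ univ.image (algebraMap F K) := by rw [h]; simpa using hc
  simpa using hmem

theorem exists_cube_iff {F K : Type*} [Field F] [Field K] [Algebra F K] [Fintype K] [CharP K 2]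
    {r n : ℕ} (hr : 0 < r) (hn : 0 < n) (hF : Nat.card F = 2 ^ r)
    (hK : Fintype.card K = 2 ^ (r * n)) {α : F} (hα : α ≠ 0) :
    (∃ c : K, c ^ 2 ^ r = c ∧ algebraMap F K α * c ^ 3 = 1) ↔ ∃ x : F, α = x ^ 3 := by
  constructor
  · rintro ⟨c, hc, h⟩
    obtain ⟨x, rfl⟩ := exists_algebraMap_eq_of_fixed hr hn hF hK c hc
    rw [← map_pow, ← map_mul, ← map_one (algebraMap F K), (algebraMap F K).injective.eq_iff] at h
    exact ⟨x⁻¹, by rw [inv_pow]; exact eq_inv_of_mul_eq_one_left h⟩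
  · rintro ⟨x, rfl⟩
    have hx : x ≠ 0 := by rintro rfl; simp at hα
    have : Finite F := Nat.finite_of_card_ne_zero (by rw [hF]; positivity)
    have := Fintype.ofFinite F
    rw [Nat.card_eq_fintype_card] at hF
    refine ⟨algebraMap F K x⁻¹, by rw [← map_pow, ← hF, FiniteField.pow_card], ?_⟩
    rw [← map_pow, ← map_mul, ← mul_pow, mul_inv_cancel₀ hx, one_pow, map_one]

variable {K : Type*} [Field K] {r n : ℕ} {a : K}

theorem exists_mul_cube_eq_one_of_odd (hr : Odd r) (ha : a ^ 2 ^ r = a) (ha0 : a ≠ 0) :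
    ∃ c : K, c ^ 2 ^ r = c ∧ a * c ^ 3 = 1 := by
  -- The exponent e = (2q - 1)/3 extracts cube roots in F_q: a^(3e+1) = a^(2q) = a^2, so (a^e)^3 =
  -- a.
  obtain ⟨e, he⟩ : ∃ e, 2 ^ (r + 1) = 3 * e + 1 := by
    obtain ⟨k, hk⟩ := hr.add_one
    have h : 2 ^ (r + 1) % 3 = 1 := by
      rw [hk, ← two_mul, pow_mul, Nat.pow_mod]; simp
    exact ⟨2 ^ (r + 1) / 3, by omega⟩
  refine ⟨(a ^ e)⁻¹, by rw [inv_pow, pow_right_comm, ha], ?_⟩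
  have h1 : a ^ (3 * e + 1) = a ^ 2 := by rw [← he, pow_two_pow_succ, ha]
  have h2 : (a ^ e) ^ 3 = a := by
    rw [← pow_mul, mul_comm e]
    exact mul_right_cancel₀ ha0 (by rw [← pow_succ, h1, sq])
  rw [inv_pow, h2, mul_inv_cancel₀ ha0]

variable [Fintype K]

theorem sum_curveSign_of_cube {N : ℕ} {c : K} (hc : c ^ 2 ^ r = c) (h : a * c ^ 3 = 1) :
    ∑ x, curveSign r N a x = ∑ x, curveSign r N (1 : K) x := by
  have hc0 : c ≠ 0 := by rintro rfl; simp at h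
  rw [← Equiv.sum_comp (Equiv.mulLeft₀ c hc0)]
  refine sum_congr rfl fun x _ => ?_
  rw [Equiv.mulLeft₀_apply, curveSign, curveFun_mul hc, h, curveSign]

variable [CharP K 2] [DecidableEq K]

theorem sum_curveSign_of_even (hr : 0 < r) (hn : 0 < n) (hn2 : Even n)
    (hK : Fintype.card K = 2 ^ (r * n)) (ha : a ^ 2 ^ r = a) (ha0 : a ≠ 0) :
    ∑ x, curveSign r (r * n) a x =
      2 ^ (r * (n + 2) / 2) * (2 - #(traceZeroRoots r (n / 2) a) : ℤ) := by
  obtain ⟨m, rfl⟩ := hn2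
  have e1 : r * (m + m) = 2 * (r * m) := by ring
  have e2 : r * (m + m + 2) / 2 = r * (m + 1) := by
    rw [show r * (m + m + 2) = r * (m + 1) * 2 by ring, Nat.mul_div_cancel _ Nat.two_pos]
  rw [e1] at hK
  rw [e1, e2, show (m + m) / 2 = m by omega]
  exact sum_curveSign_even hr (by omega) hK ha ha0

end Values

/-! ### Assembling the cases -/

theorem mainTheorem4 {F K : Type*} [Field F] [Field K] [Algebra F K] (r n : ℕ)
    (hr : 1 ≤ r) (hn : 1 ≤ n) (hF : Nat.card F = 2 ^ r) (hK : Nat.card K = 2 ^ (r * n))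
    (α : F) (hα : α ≠ 0) :
    (Odd r →
      ((n % 8 = 1 ∨ n % 8 = 7) →
        (Nat.card (curvePoints r α K) : ℤ) = (2 ^ (r * n) + 1) + 2 ^ (r * (n + 1) / 2)) ∧
      ((n % 8 = 3 ∨ n % 8 = 5) →
        (Nat.card (curvePoints r α K) : ℤ) = (2 ^ (r * n) + 1) - 2 ^ (r * (n + 1) / 2)) ∧
      ((n % 8 = 2 ∨ n % 8 = 6) →
        (Nat.card (curvePoints r α K) : ℤ) = (2 ^ (r * n) + 1) + 2 ^ (r * (n + 2) / 2)) ∧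
      (n % 8 = 4 →
        (Nat.card (curvePoints r α K) : ℤ) = 2 ^ (r * n) + 1) ∧
      (n % 8 = 0 →
        (Nat.card (curvePoints r α K) : ℤ) = (2 ^ (r * n) + 1) - 2 ^ (r * (n + 2) / 2 + 1))) ∧
    (Even r → (∃ x : F, α = x ^ 3) →
      ((n % 4 = 1 ∨ n % 4 = 3) →
        (Nat.card (curvePoints r α K) : ℤ) = (2 ^ (r * n) + 1) + 2 ^ (r * (n + 1) / 2)) ∧
      (n % 4 = 2 →
        (Nat.card (curvePoints r α K) : ℤ) = (2 ^ (r * n) + 1) + 2 ^ (r * (n + 2) / 2)) ∧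
      (n % 4 = 0 →
        (Nat.card (curvePoints r α K) : ℤ) = (2 ^ (r * n) + 1) - 2 ^ (r * (n + 2) / 2 + 1))) ∧
    (Even r → (¬ ∃ x : F, α = x ^ 3) →
      (Nat.gcd n 6 = 1 →
        (Nat.card (curvePoints r α K) : ℤ) = (2 ^ (r * n) + 1) + 2 ^ (r * (n + 1) / 2)) ∧
      (Nat.gcd n 6 = 2 →
        (Nat.card (curvePoints r α K) : ℤ) = (2 ^ (r * n) + 1) + 2 ^ (r * (n + 2) / 2)) ∧
      (Nat.gcd n 6 = 3 →
        (Nat.card (curvePoints r α K) : ℤ) = (2 ^ (r * n) + 1) - 2 ^ (r * (n + 1) / 2 + 1)) ∧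
      (Nat.gcd n 6 = 6 →
        (Nat.card (curvePoints r α K) : ℤ) = (2 ^ (r * n) + 1) - 2 ^ (r * (n + 2) / 2 + 1))) := by
  classical
  have : Finite K := Nat.finite_of_card_ne_zero (by rw [hK]; positivity)
  have := Fintype.ofFinite K
  rw [Nat.card_eq_fintype_card] at hK
  have hN : 0 < r * n := Nat.mul_pos hr hn
  have hchar : CharP K 2 := by
    refine CharTwo.of_one_ne_zero_of_two_eq_zero one_ne_zero ?_
    have h := Nat.cast_card_eq_zero K
    rw [hK, Nat.cast_pow] at h
    exact_mod_cast eq_zero_of_pow_eq_zero h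
  rw [card_curvePoints hr hN hK hα]
  have hcube := exists_cube_iff hr hn hF hK hα
  have ha0 : algebraMap F K α ≠ 0 := (map_ne_zero _).2 hα
  have ha : algebraMap F K α ^ 2 ^ r = algebraMap F K α := by
    have : Finite F := Nat.finite_of_card_ne_zero (by rw [hF]; positivity)
    have := Fintype.ofFinite F
    rw [Nat.card_eq_fintype_card] at hF
    rw [← map_pow, ← hF, FiniteField.pow_card]
  generalize algebraMap F K α = a at hcube ha0 ha ⊢
  have hoddexp (hn2 : Odd n) : r * (n + 1) / 2 = r * ((n + 1) / 2) :=
    Nat.mul_div_assoc r hn2.add_one.two_dvd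
  have heven (hn2 : Even n) := sum_curveSign_of_even hr hn hn2 hK ha ha0
  refine ⟨fun hr2 => ?_, fun hr2 hα3 => ?_, fun hr2 hα3 => ?_⟩
  · obtain ⟨c, hc, hac⟩ := exists_mul_cube_eq_one_of_odd hr2 ha ha0
    have hodd (hn2 : Odd n) := sum_curveSign_odd_of_odd hr2 n hn2 K hK
    rw [card_traceZeroRoots_of_cube hc hac] at heven
    have hroot (hn2 : Even n) := exists_cubeRoot hN (hn2.mul_left r) hK
    refine ⟨fun h => ?_, fun h => ?_, fun h => ?_, fun h => ?_, fun h => ?_⟩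
    · have hn2 : Odd n := Nat.odd_iff.2 (by omega)
      rw [sum_curveSign_of_cube hc hac, hodd hn2, hoddexp hn2, ZMod.χ₈_nat_eq_if_mod_eight,
        if_neg (by omega), if_pos h, one_mul]
    · have hn2 : Odd n := Nat.odd_iff.2 (by omega)
      rw [sum_curveSign_of_cube hc hac, hodd hn2, hoddexp hn2, ZMod.χ₈_nat_eq_if_mod_eight,
        if_neg (by omega), if_neg (by omega), neg_one_mul, sub_eq_add_neg]
    · rw [heven (Nat.even_iff.2 (by omega)),
        card_traceZeroRoots_one_of_odd_odd hr2 (Nat.odd_iff.2 (by omega))]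
      push_cast; ring
    · have hn2 : Even n := Nat.even_iff.2 (by omega)
      obtain ⟨w, hw⟩ := hroot hn2
      rw [heven hn2, (card_traceZeroRoots_one_of_odd hw hr2).1 (by omega)]
      push_cast; ring
    · have hn2 : Even n := Nat.even_iff.2 (by omega)
      obtain ⟨w, hw⟩ := hroot hn2
      rw [heven hn2, (card_traceZeroRoots_one_of_odd hw hr2).2 (by omega)]
      push_cast; ring
  · obtain ⟨c, hc, hac⟩ := hcube.2 hα3
    obtain ⟨w, hw⟩ := exists_cubeRoot hN (hr2.mul_right n) hK
    rw [card_traceZeroRoots_of_cube hc hac] at heven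
    refine ⟨fun h => ?_, fun h => ?_, fun h => ?_⟩
    · have hn2 : Odd n := Nat.odd_iff.2 (by omega)
      rw [(sum_curveSign_odd_of_even hr hr2 hn2 hK ha ha0 hw).1, hoddexp hn2]
      rw [card_traceZeroRoots_of_cube hc hac, (card_traceZeroRoots_one_of_even hw hr2).1 hn2]
    · rw [heven (Nat.even_iff.2 (by omega)),
        (card_traceZeroRoots_one_of_even hw hr2).1 (Nat.odd_iff.2 (by omega))]
      push_cast; ring
    · rw [heven (Nat.even_iff.2 (by omega)),
        (card_traceZeroRoots_one_of_even hw hr2).2 (Nat.even_iff.2 (by omega))]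
      push_cast; ring
  · obtain ⟨w, hw⟩ := exists_cubeRoot hN (hr2.mul_right n) hK
    have hnot : ¬∃ c : K, c ^ 2 ^ r = c ∧ a * c ^ 3 = 1 := fun h => hα3 (hcube.1 h)
    have hgcd {p : ℕ} (hp : p ∣ 6) : p ∣ n ↔ p ∣ Nat.gcd n 6 :=
      ⟨fun h => Nat.dvd_gcd h hp, fun h => h.trans (Nat.gcd_dvd_left n 6)⟩
    have hg2 := hgcd (show 2 ∣ 6 by norm_num)
    have hg3 := hgcd (show 3 ∣ 6 by norm_num)
    have hT (h3 : 3 ∣ n) := exists_mul_cube_eq_one hr2 h3 hK ha ha0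
    refine ⟨fun h => ?_, fun h => ?_, fun h => ?_, fun h => ?_⟩ <;> rw [h] at hg2 hg3
    · have hn2 : Odd n := Nat.odd_iff.2 (by omega)
      rw [(sum_curveSign_odd_of_even hr hr2 hn2 hK ha ha0 hw).1
        ((card_traceZeroRoots_of_not_cube hr2 ha ha0 hnot).1 (by omega)), hoddexp hn2]
    · rw [heven (Nat.even_iff.2 (by omega)),
        (card_traceZeroRoots_of_not_cube hr2 ha ha0 hnot).1 (by omega)]
      push_cast; ring
    · have hn2 : Odd n := Nat.odd_iff.2 (by omega)
      rw [(sum_curveSign_odd_of_even hr hr2 hn2 hK ha ha0 hw).2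
        ((card_traceZeroRoots_of_not_cube hr2 ha ha0 hnot).2 (by omega) (hT (by omega))),
        hoddexp hn2, sub_eq_add_neg]
    · rw [heven (Nat.even_iff.2 (by omega)),
        (card_traceZeroRoots_of_not_cube hr2 ha ha0 hnot).2 (by omega) (hT (by omega))]
      push_cast; ring
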